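/- \textbf{Setting.} All Hilbert spaces are complex and separable. Let $\mathcal E,\mathcal E_*$ be Hilbert spaces, $\mathbb D$ the open unit disc and $\mathbb T$ its boundary with normalized Lebesgue measure. $L^2_{\mathcal E}$ is the space of square integrable $\mathcal E$-valued functions on $\mathbb T$, and $H^2_{\mathcal E}\subseteq L^2_{\mathcal E}$ is the Hardy space (functions whose Fourier coefficients of negative index vanish), each $u\in H^2_{\mathcal E}$ being identified with its analytic extension $u(z)=\sum_{n\ge 0}\hat u(n)z^n$ to $\mathbb D$; orthogonal complements of $H^2_{\mathcal E}$ are taken in $L^2_{\mathcal E}$. A purely contractive analytic function is an analytic $\Theta:\mathbb D\to\mathcal B(\mathcal E,\mathcal E_*)$ with $\|\Theta(z)a\|\le\|a\|$ for all $z\in\mathbb D$, $a\in\mathcal E$, and $\|\Theta(0)a\|<\|a\|$ for all $a\ne 0$. Its boundary function $\Theta(e^{it})$ is the radial limit in the strong operator topology (a.e.), $\Delta_\Theta(e^{it})=[I-\Theta(e^{it})^*\Theta(e^{it})]^{1/2}$, and $T_\Theta:H^2_{\mathcal E}\to H^2_{\mathcal E_*}$, $T_\Theta h=P_+(\Theta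 h)$, is the Toeplitz operator, where $P_+$ is the orthogonal projection of $L^2_{\mathcal E_*}$ onto $H^2_{\mathcal E_*}$. The Sz.-Nagy--Foia\c{s} model space of $\Theta$ is the Hilbert space \[ \mathcal H=\bigl(H^2_{\mathcal E_*}\oplus\overline{\Delta_\Theta L^2_{\mathcal E}}\bigr)\ominus\{\Theta h\oplus\Delta_\Theta h: h\in H^2_{\mathcal E}\}. \] A bounded operator is a partial isometry if it is isometric on the orthogonal complement of its kernel, and $T$ is a power partial isometry if $T^n$ is a partial isometry for every $n\ge1$. A contraction $T$ on $\mathcal H$ is completely non-unitary (c.n.u.) if no nonzero closed subspace reduces $T$ to a unitary operator. Put $D_T=(I-T^*T)^{1/2}$, $D_{T^*}=(I-TT^*)^{1/2}$, $\mathcal D_T=\overline{\operatorname{ran}}\,D_T$, $\mathcal D_{T^*}=\overline{\operatorname{ran}}\,D_{T^*}$. The characteristic function of a contraction $T$ is $\Theta_T(z)=[-T+zD_{T^*}(I-zT^*)^{-1}D_T]|_{\mathcal D_T}:\mathcal D_T\to\mathcal D_{T^*}$, $z\in\mathbb D$. Functions $\Phi:\mathbb D\to\mathcal B(\mathcal F,\mathcal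 F_*)$ and $\Theta:\mathbb D\to\mathcal B(\mathcal E,\mathcal E_*)$ coincide if there are unitaries $\tau:\mathcal F\to\mathcal E$, $\tau_*:\mathcal F_*\to\mathcal E_*$ with $\tau_*\Phi(z)=\Theta(z)\tau$ for all $z\in\mathbb D$. \textbf{Theorem.} Let $\Theta:\mathbb D\to\mathcal B(\mathcal E,\mathcal E_*)$ be a purely contractive analytic function with $\Theta(z)=\sum_{m=1}^\infty\theta_m z^m$ $(z\in\mathbb D)$, where every $\theta_m\in\mathcal B(\mathcal E,\mathcal E_*)$, $m\ge1$, is a partial isometry. Then: \begin{enumerate} \item the boundary function $\Theta(e^{it})$ exists a.e. on $\mathbb T$ and belongs to $L^\infty_{\mathcal B(\mathcal E,\mathcal E_*)}$ (strongly measurable and essentially bounded), and $\Delta_\Theta$ is a constant projection: there is an orthogonal projection $P$ on $\mathcal E$ with $\Delta_\Theta(e^{it})=P$ a.e., and $\Delta_\Theta(e^{it})^2=I-\Theta(e^{it})^*\Theta(e^{it})$ a.e.; \item the model space of $\Theta$ is \[ \mathcal H=\left\{(I-T_\Theta T_\Theta^*)f\oplus\Delta_\Theta g:\ f\in H^2_{\mathcal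 E_*},\ g\in[H^2_{\mathcal E}]^\perp\right\}; \] \item there is a bounded operator $T$ on $\mathcal H$ with \[ T^*(u\oplus v)=e^{-it}\bigl(u(e^{it})-u(0)\bigr)\oplus e^{-it}v(e^{it})\qquad(u\oplus v\in\mathcal H), \] and $T$ is a c.n.u. contraction and a power partial isometry whose characteristic function coincides with $\Theta$. \end{enumerate} -/

import Mathlib

open MeasureTheory Filter Topology ContinuousLinearMap
open scoped ENNReal InnerProductSpace InnerProduct

noncomputable section

namespace PowerPartial

/-! ### Partial isometries, completely non-unitary operators, characteristic functions -/

section Operators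

variable {H : Type*} [NormedAddCommGroup H] [InnerProductSpace ℂ H]
variable {K : Type*} [NormedAddCommGroup K] [InnerProductSpace ℂ K]

/-- `T` is isometric on the orthogonal complement of its kernel. -/
def IsPartialIsometry (T : H →L[ℂ] K) : Prop :=
  ∀ x ∈ (LinearMap.ker (T : H →ₗ[ℂ] K))ᗮ, ‖T x‖ = ‖x‖

/-- Every positive power of `T` is a partial isometry. -/
def IsPowerPartialIsometry (T : H →L[ℂ] H) : Prop :=
  ∀ n : ℕ, 1 ≤ n → IsPartialIsometry (T ^ n)

/-- `T` is a contraction. -/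
def IsContraction (T : H →L[ℂ] K) : Prop := ∀ x, ‖T x‖ ≤ ‖x‖

variable [CompleteSpace H] [CompleteSpace K]

/-- `T` is a completely non-unitary contraction: no nonzero closed subspace `L` that is invariant
under `T` and `T†` is such that `T` restricts to a unitary (a surjective isometry) of `L`. -/
def IsCNU (T : H →L[ℂ] H) : Prop :=
  IsContraction T ∧
  ∀ L : Submodule ℂ H, IsClosed (L : Set H) →
    (∀ x ∈ L, T x ∈ L) → (∀ x ∈ L, (T†) x ∈ L) →
    (∀ x ∈ L, ‖T x‖ = ‖x‖) → (∀ y ∈ L, ∃ x ∈ L, T x = y) → L = ⊥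

/-- The defect operator `D_T = (I - T* T)^{1/2}`. -/
def defectOp (T : H →L[ℂ] H) : H →L[ℂ] H := CFC.sqrt (1 - (T†) * T)

/-- The defect space, the closure of the range of `D_T`. -/
def defectSpace (T : H →L[ℂ] H) : Submodule ℂ H :=
  (LinearMap.range (defectOp T : H →ₗ[ℂ] H)).topologicalClosure

/-- `-T + z D_{T*} (I - z T*)⁻¹ D_T` on the whole space. -/
def charOp (T : H →L[ℂ] H) (z : ℂ) : H →L[ℂ] H :=
  -T + z • (defectOp (T†) * Ring.inverse (1 - z • (T†)) * defectOp T)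

theorem isContraction_adjoint {T : H →L[ℂ] H} (hT : IsContraction T) : IsContraction (T†) := by
  have h1 : ‖T‖ ≤ 1 := T.opNorm_le_bound zero_le_one (fun x => by simpa using hT x)
  intro x
  have h2 : ‖T†‖ ≤ 1 := by simpa using h1
  simpa using (T†).le_of_opNorm_le h2 x

theorem one_sub_nonneg_of_isContraction {T : H →L[ℂ] H} (hT : IsContraction T) :
    0 ≤ 1 - (T†) * T := by
  rw [ContinuousLinearMap.nonneg_iff_isPositive, ContinuousLinearMap.isPositive_def']
  refine ⟨?_, fun x => ?_⟩
  · have h := IsSelfAdjoint.star_mul_self T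
    exact (IsSelfAdjoint.one _).sub h
  · have h := hT x
    rw [ContinuousLinearMap.reApplyInnerSelf_apply]
    have e : (1 - (T†) * T) x = x - (T†) (T x) := rfl
    rw [e, inner_sub_left, ContinuousLinearMap.adjoint_inner_left, map_sub,
      inner_self_eq_norm_sq, inner_self_eq_norm_sq]
    nlinarith [norm_nonneg (T x), norm_nonneg x]

theorem ker_defectOp {T : H →L[ℂ] H} (hT : IsContraction T) (x : H) :
    defectOp T x = 0 ↔ (T†) (T x) = x := by
  have hsq : defectOp T * defectOp T = 1 - (T†) * T :=
    CFC.sqrt_mul_sqrt_self _ (one_sub_nonneg_of_isContraction hT)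
  have hsa : (defectOp T)† = defectOp T :=
    (IsSelfAdjoint.of_nonneg (CFC.sqrt_nonneg (1 - (T†) * T))).adjoint_eq
  have hx : defectOp T (defectOp T x) = x - (T†) (T x) := by
    have := congrArg (fun A : H →L[ℂ] H => A x) hsq
    simpa using this
  constructor
  · intro h
    rw [h, map_zero] at hx
    exact (sub_eq_zero.mp hx.symm).symm
  · intro h
    rw [h, sub_self] at hx
    have : ⟪defectOp T x, defectOp T x⟫_ℂ = 0 := by
      rw [← ContinuousLinearMap.adjoint_inner_left, hsa, hx, inner_zero_left]
    exact inner_self_eq_zero.mp this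

theorem defectSpace_eq (T : H →L[ℂ] H) :
    defectSpace T = (LinearMap.ker (defectOp T : H →ₗ[ℂ] H))ᗮ := by
  have hsa : (defectOp T)† = defectOp T :=
    (IsSelfAdjoint.of_nonneg (CFC.sqrt_nonneg (1 - (T†) * T))).adjoint_eq
  have := ContinuousLinearMap.orthogonal_range (defectOp T)
  rw [hsa] at this
  rw [← this, Submodule.orthogonal_orthogonal_eq_closure]
  rfl

theorem charOp_mem {T : H →L[ℂ] H} (hT : IsContraction T) (z : ℂ) (x : H)
    (hx : x ∈ defectSpace T) : charOp T z x ∈ defectSpace (T†) := by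
  have h1 : T x ∈ defectSpace (T†) := by
    rw [defectSpace_eq] at hx ⊢
    intro y hy
    have hy' : T ((T†) y) = y := by
      have := (ker_defectOp (isContraction_adjoint hT) y).mp (by simpa using hy)
      simpa using this
    rw [← ContinuousLinearMap.adjoint_inner_left]
    apply hx
    change defectOp T ((T†) y) = 0
    rw [ker_defectOp hT, hy']
  have h2 : ∀ y, defectOp (T†) y ∈ defectSpace (T†) := fun y =>
    Submodule.le_topologicalClosure _ ⟨y, rfl⟩
  exact Submodule.add_mem _ (Submodule.neg_mem _ h1) (Submodule.smul_mem _ _ (h2 _))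

/-- The characteristic function `Θ_T(z) = [-T + z D_{T*} (I - z T*)⁻¹ D_T]` restricted to the
defect space of `T`, with values in the defect space of `T*`. -/
def charFun (T : H →L[ℂ] H) (hT : IsContraction T) (z : ℂ) :
    defectSpace T →L[ℂ] defectSpace (T†) :=
  (charOp T z ∘L (defectSpace T).subtypeL).codRestrict (defectSpace (T†))
    (fun x => charOp_mem hT z x x.2)

end Operators

section Analytic

variable {E : Type*} [NormedAddCommGroup E] [InnerProductSpace ℂ E]
variable {F : Type*} [NormedAddCommGroup F] [InnerProductSpace ℂ F]
variable {E' : Type*} [NormedAddCommGroup E'] [InnerProductSpace ℂ E']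
variable {F' : Type*} [NormedAddCommGroup F'] [InnerProductSpace ℂ F']

/-- Purely contractive analytic functions on the open unit disc
(values outside the disc are irrelevant). -/
structure IsPurelyContractiveAnalytic (Θ : ℂ → E →L[ℂ] F) : Prop where
  analytic : DifferentiableOn ℂ Θ (Metric.ball 0 1)
  contractive : ∀ z ∈ Metric.ball (0 : ℂ) 1, ∀ a, ‖Θ z a‖ ≤ ‖a‖
  pure : ∀ a, a ≠ 0 → ‖Θ 0 a‖ < ‖a‖

/-- Coincidence of two operator-valued functions on the open unit disc. -/
def Coincide (Θ : ℂ → E →L[ℂ] F) (Φ : ℂ → E' →L[ℂ] F') : Prop :=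
  ∃ (τ : E ≃ₗᵢ[ℂ] E') (τ' : F ≃ₗᵢ[ℂ] F'),
    ∀ z ∈ Metric.ball (0 : ℂ) 1, ∀ a, τ' (Θ z a) = Φ z (τ a)

end Analytic

/-! ### Vector-valued `L²` and Hardy spaces on the circle `ℝ / 2πℤ` -/

instance fact_two_pi_pos : Fact (0 < 2 * Real.pi) := ⟨Real.two_pi_pos⟩

/-- The unit circle, parametrised by the angle `t`. -/
abbrev 𝕋 : Type := AddCircle (2 * Real.pi)

/-- Normalized Lebesgue measure on the circle. -/
abbrev μ𝕋 : Measure 𝕋 := AddCircle.haarAddCircle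

/-- `e^{int}` as a function of the angle `t`. -/
abbrev expi (n : ℤ) (t : 𝕋) : ℂ := fourier n t

section Hardy

variable (E : Type*) [NormedAddCommGroup E] [InnerProductSpace ℂ E]
variable (F : Type*) [NormedAddCommGroup F] [InnerProductSpace ℂ F]

/-- Square integrable `E`-valued functions on the circle. -/
abbrev L2 : Type _ := Lp E 2 μ𝕋

variable {E F}

theorem integrable_L2 {G : Type*} [NormedAddCommGroup G] (f : L2 G) : Integrable f μ𝕋 :=
  (Lp.memLp f).integrable (by norm_num)

variable (E) in
/-- The `n`-th Fourier coefficient, as a bounded operator on `L²`. -/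
def coeffL (n : ℤ) : L2 E →L[ℂ] E :=
  LinearMap.mkContinuous
    { toFun := fun f => fourierCoeff f n
      map_add' := fun f g => by
        rw [fourierCoeff_congr_ae (Lp.coeFn_add f g),
          fourierCoeff.add (integrable_L2 f) (integrable_L2 g)]
        rfl
      map_smul' := fun c f => by
        rw [fourierCoeff_congr_ae (Lp.coeFn_smul c f), fourierCoeff.const_smul]
        rfl }
    1 (fun f => by
      have h1 : ‖fourierCoeff f n‖ ≤ ∫ t, ‖f t‖ ∂μ𝕋 := by
        refine (norm_integral_le_integral_norm _).trans (le_of_eq ?_)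
        congr 1
        ext t
        rw [norm_smul, fourier_norm_apply, one_mul]
      have h2 : ∫ t, ‖f t‖ ∂μ𝕋 ≤ ‖f‖ := by
        rw [integral_norm_eq_lintegral_enorm (Lp.aestronglyMeasurable f),
          ← eLpNorm_one_eq_lintegral_enorm, Lp.norm_def]
        exact ENNReal.toReal_mono (Lp.eLpNorm_ne_top f)
          (eLpNorm_le_eLpNorm_of_exponent_le (by norm_num) (Lp.aestronglyMeasurable f))
      simpa using h1.trans h2)
where
  fourier_norm_apply {n : ℤ} (t : 𝕋) : ‖(fourier n t : ℂ)‖ = 1 := by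
    rw [fourier_apply, Circle.norm_coe]

variable (E) in
/-- The Hardy space `H²_E`, identified with its boundary functions: the closed subspace of the
`f ∈ L²_E` whose Fourier coefficients of negative index all vanish. -/
def H2 : Submodule ℂ (L2 E) :=
  ⨅ n : {n : ℤ // n < 0}, LinearMap.ker (coeffL E n : L2 E →ₗ[ℂ] E)

theorem mem_H2 {f : L2 E} : f ∈ H2 E ↔ ∀ n : ℤ, n < 0 → fourierCoeff f n = 0 := by
  simp only [H2, Submodule.mem_iInf, Subtype.forall]
  rfl

theorem isClosed_H2 : IsClosed (H2 E : Set (L2 E)) := by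
  rw [H2, Submodule.coe_iInf]
  exact isClosed_iInter fun n => (coeffL E n).isClosed_ker

/-- The value at `z` in the disc of the analytic function with boundary function `f`. -/
def discValue (f : L2 E) (z : ℂ) : E := ∑' n : ℕ, z ^ n • fourierCoeff f (n : ℤ)

theorem discValue_zero (f : L2 E) : discValue f 0 = fourierCoeff f 0 := by
  rw [discValue, tsum_eq_single 0 (fun n hn => by simp [hn])]
  simp

/-- Strongly measurable, essentially bounded operator-valued functions on the circle. -/
structure IsLInfty (Φ : 𝕋 → E →L[ℂ] F) : Prop where
  meas : ∀ a, AEStronglyMeasurable (fun t => Φ t a) μ𝕋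
  bdd : ∃ C : ℝ, ∀ᵐ t ∂μ𝕋, ‖Φ t‖ ≤ C

theorem IsLInfty.aestronglyMeasurable_apply {Φ : 𝕋 → E →L[ℂ] F} (hΦ : IsLInfty Φ)
    {f : 𝕋 → E} (hf : AEStronglyMeasurable f μ𝕋) :
    AEStronglyMeasurable (fun t => Φ t (f t)) μ𝕋 := by
  have hsimple : ∀ s : SimpleFunc 𝕋 E, AEStronglyMeasurable (fun t => Φ t (s t)) μ𝕋 := by
    intro s
    have : (fun t => Φ t (s t)) =
        fun t => ∑ a ∈ s.range, (s ⁻¹' {a}).indicator (fun t => Φ t a) t := by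
      funext t
      rw [Finset.sum_eq_single (s t)]
      · simp
      · intro b _ hb
        exact Set.indicator_of_notMem (fun h => hb (by simpa using h.symm)) _
      · intro h
        exact absurd (SimpleFunc.mem_range_self s t) h
    rw [this]
    exact Finset.aestronglyMeasurable_fun_sum _ fun a _ =>
      (hΦ.meas a).indicator (s.measurableSet_preimage {a})
  have hmk := hf.stronglyMeasurable_mk
  have h2 : AEStronglyMeasurable (fun t => Φ t (hf.mk f t)) μ𝕋 :=
    aestronglyMeasurable_of_tendsto_ae atTop (fun n => hsimple (hmk.approx n))
      (ae_of_all _ fun t => ((Φ t).continuous.tendsto _).comp (hmk.tendsto_approx t))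
  refine h2.congr ?_
  filter_upwards [hf.ae_eq_mk] with t ht
  rw [ht]

theorem IsLInfty.bound_apply {Φ : 𝕋 → E →L[ℂ] F} (hΦ : IsLInfty Φ) (f : L2 E) :
    ∀ᵐ t ∂μ𝕋, ‖Φ t (f t)‖ ≤ hΦ.bdd.choose * ‖f t‖ := by
  filter_upwards [hΦ.bdd.choose_spec] with t ht
  exact (Φ t).le_of_opNorm_le ht _

theorem IsLInfty.memLp_apply {Φ : 𝕋 → E →L[ℂ] F} (hΦ : IsLInfty Φ) (f : L2 E) :
    MemLp (fun t => Φ t (f t)) 2 μ𝕋 :=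
  (Lp.memLp f).of_le_mul (hΦ.aestronglyMeasurable_apply (Lp.aestronglyMeasurable f))
    (hΦ.bound_apply f)

open Classical in
/-- The Laurent operator `h ↦ Φ h` from `L²_E` to `L²_F`
(by convention zero if `Φ` is not in `L^∞`). -/
def laurent (Φ : 𝕋 → E →L[ℂ] F) : L2 E →L[ℂ] L2 F :=
  if hΦ : IsLInfty Φ then
    LinearMap.mkContinuous
      { toFun := fun f => (hΦ.memLp_apply f).toLp
        map_add' := fun f g => by
          rw [← MemLp.toLp_add]
          refine MemLp.toLp_congr _ _ ?_
          filter_upwards [Lp.coeFn_add f g] with t ht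
          change Φ t ((f + g : L2 E) t) = Φ t (f t) + Φ t (g t)
          rw [ht, Pi.add_apply, map_add]
        map_smul' := fun c f => by
          rw [RingHom.id_apply, ← MemLp.toLp_const_smul]
          refine MemLp.toLp_congr _ _ ?_
          filter_upwards [Lp.coeFn_smul c f] with t ht
          change Φ t ((c • f : L2 E) t) = c • Φ t (f t)
          rw [ht, Pi.smul_apply, map_smul] }
      hΦ.bdd.choose (fun f => by
        refine Lp.norm_le_mul_norm_of_ae_le_mul ?_
        filter_upwards [(hΦ.memLp_apply f).coeFn_toLp, hΦ.bound_apply f] with t h1 h2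
        change ‖(hΦ.memLp_apply f).toLp _ t‖ ≤ _
        rw [h1]
        exact h2)
  else 0

theorem laurent_coeFn {Φ : 𝕋 → E →L[ℂ] F} (hΦ : IsLInfty Φ) (f : L2 E) :
    laurent Φ f =ᵐ[μ𝕋] fun t => Φ t (f t) := by
  rw [laurent, dif_pos hΦ]
  exact (hΦ.memLp_apply f).coeFn_toLp

/-- `A` is the radial limit of `Θ` at the boundary point `e^{it}` in the strong operator
topology. -/
def IsRadialLimit (Θ : ℂ → E →L[ℂ] F) (t : 𝕋) (A : E →L[ℂ] F) : Prop :=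
  ∀ a, Tendsto (fun r : ℝ => Θ ((r : ℂ) * expi 1 t) a) (𝓝[<] 1) (𝓝 (A a))

open Classical in
/-- The boundary function `Θ(e^{it})`, the strong radial limit where it exists. -/
def boundary (Θ : ℂ → E →L[ℂ] F) (t : 𝕋) : E →L[ℂ] F :=
  if h : ∃ A, IsRadialLimit Θ t A then h.choose else 0

variable [CompleteSpace E] [CompleteSpace F]

instance : CompleteSpace (H2 E) := isClosed_H2.completeSpace_coe

/-- The Toeplitz operator `h ↦ P₊ (Φ h)` from `H²_E` to `H²_F`. -/
def toeplitz (Φ : 𝕋 → E →L[ℂ] F) : H2 E →L[ℂ] H2 F :=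
  (H2 F).orthogonalProjectionOnto ∘L laurent Φ ∘L (H2 E).subtypeL

/-- `Δ_Θ(e^{it}) = [I - Θ(e^{it})* Θ(e^{it})]^{1/2}`. -/
def delta (Θ : ℂ → E →L[ℂ] F) (t : 𝕋) : E →L[ℂ] E :=
  CFC.sqrt (1 - (boundary Θ t)† ∘L boundary Θ t)

/-- `𝒦₊ = H²_F ⊕ closure (Δ_Θ L²_E)`, as a subspace of `L²_F ⊕ L²_E`. -/
def kPlus (Θ : ℂ → E →L[ℂ] F) : Submodule ℂ (WithLp 2 (L2 F × L2 E)) :=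
  (H2 F).comap (WithLp.fstL 2 ℂ (L2 F) (L2 E) : WithLp 2 (L2 F × L2 E) →ₗ[ℂ] L2 F) ⊓
  (LinearMap.range (laurent (delta Θ) : L2 E →ₗ[ℂ] L2 E)).topologicalClosure.comap
    (WithLp.sndL 2 ℂ (L2 F) (L2 E) : WithLp 2 (L2 F × L2 E) →ₗ[ℂ] L2 E)

/-- The subspace `{Θ h ⊕ Δ_Θ h : h ∈ H²_E}` of `L²_F ⊕ L²_E`. -/
def graphSpace (Θ : ℂ → E →L[ℂ] F) : Submodule ℂ (WithLp 2 (L2 F × L2 E)) :=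
  (H2 E).map ((WithLp.linearEquiv 2 ℂ (L2 F × L2 E)).symm.toLinearMap ∘ₗ
    LinearMap.prod (laurent (boundary Θ) : L2 E →ₗ[ℂ] L2 F)
      (laurent (delta Θ) : L2 E →ₗ[ℂ] L2 E))

/-- The Sz.-Nagy–Foiaş model space `𝒦₊ ⊖ {Θ h ⊕ Δ_Θ h : h ∈ H²_E}`. -/
def modelSpace (Θ : ℂ → E →L[ℂ] F) : Submodule ℂ (WithLp 2 (L2 F × L2 E)) :=
  kPlus Θ ⊓ (graphSpace Θ)ᗮ

theorem isClosed_modelSpace (Θ : ℂ → E →L[ℂ] F) :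
    IsClosed (modelSpace Θ : Set (WithLp 2 (L2 F × L2 E))) := by
  refine IsClosed.inter (IsClosed.inter ?_ ?_) (Submodule.isClosed_orthogonal _)
  · exact isClosed_H2.preimage (WithLp.fstL 2 ℂ (L2 F) (L2 E)).continuous
  · exact (Submodule.isClosed_topologicalClosure _).preimage
      (WithLp.sndL 2 ℂ (L2 F) (L2 E)).continuous

instance (Θ : ℂ → E →L[ℂ] F) : CompleteSpace (modelSpace Θ) :=
  (isClosed_modelSpace Θ).completeSpace_coe

end Hardy

end PowerPartial

end

/-! Put η_m = θ_{m+1}. Parseval on circles of radius r < 1, followed by r → 1, turns ‖Θ(z)a‖ ≤ ‖a‖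
into ∑ ‖η_m a‖² ≤ ‖a‖². For a = η_m* b the m-th term alone is ‖a‖², so η_k η_m* = 0 for k ≠ m; the
same argument for z ↦ Θ(z̄)* gives η_k* η_m = 0 (`isOrthogonalSeries_of_isPartialIsometry`). Hence
Θ(e^{it})a is an orthogonal sum for every t, and Θ(e^{it})*Θ(e^{it}) = ∑ η_m* η_m is a projection
independent of t. Its complement Δ is the projection onto ⋂ ker η_m.

A constant Δ preserves H² and its complement, so the model space splits into the u ∈ H² orthogonal
to ΘH² and the v ∈ (H²)ᗮ with values in ran Δ. In Fourier coefficients this says η_m* û(k+m+1) = 0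
and η_m v̂(n) = 0 (`mem_modelSpace_iff_coeffL`), and R = T* lowers indices by one.

Let J embed F as constants (in the model space because Θ(0) = 0) and let W a = e^{-it}(Θa ⊕ Δa).
Both are isometric, R*R = 1 - JJ* and RR* = 1 - WW*. So the defect operators of T are projections, T
W = 0, and the characteristic function has coefficients J* Rⁿ W = η_n. Each e^{int} û(n) ⊕ 0 is
again in the model space, so a vector orthogonal to ker Rⁿ has no coefficients û(i) with i < n, and
Rⁿ is isometric there. On a unitary part J* and W* vanish along all orbits, and these values
determine all coefficients, so T is c.n.u. -/

namespace PowerPartial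

/-! ### Fourier expansion of vector-valued L² functions -/

section Fourier

variable {E : Type*} [NormedAddCommGroup E] [InnerProductSpace ℂ E]

theorem norm_expi (n : ℤ) (t : 𝕋) : ‖expi n t‖ = 1 := by
  rw [expi, fourier_apply, Circle.norm_coe]

theorem expi_zero (n : ℤ) : expi n 0 = 1 := fourier_eval_zero n

theorem expi_mul (m n : ℤ) (t : 𝕋) : expi m t * expi n t = expi (m + n) t := fourier_add.symm

theorem expi_one_pow (n : ℕ) (t : 𝕋) : expi 1 t ^ (n + 1) = expi ((n : ℤ) + 1) t := by
  induction n with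
  | zero => simp
  | succ n ih => rw [pow_succ, ih, expi_mul]; push_cast; rfl

theorem isLInfty_expi (k : ℤ) :
    IsLInfty (fun t : 𝕋 => expi k t • ContinuousLinearMap.id ℂ E) where
  meas a := ((fourier k).continuous.smul continuous_const).aestronglyMeasurable
  bdd := ⟨1, ae_of_all _ fun t => by
    rw [norm_smul, norm_expi, one_mul]
    exact ContinuousLinearMap.norm_id_le⟩

/-- Multiplication by `e^{ikt}` on `L²`. -/
noncomputable def mulExp (k : ℤ) : L2 E →ₗᵢ[ℂ] L2 E where
  toLinearMap := (laurent (fun t : 𝕋 => expi k t • ContinuousLinearMap.id ℂ E) : L2 E →L[ℂ] L2 E)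
  norm_map' f := by
    rw [Lp.norm_def, Lp.norm_def]
    congr 1
    refine eLpNorm_congr_norm_ae ?_
    filter_upwards [laurent_coeFn (isLInfty_expi (E := E) k) f] with t ht
    rw [coe_coe, ht, smul_apply, norm_smul, norm_expi, one_mul, id_apply]

theorem mulExp_coeFn (k : ℤ) (f : L2 E) : mulExp k f =ᵐ[μ𝕋] fun t => expi k t • f t :=
  laurent_coeFn (isLInfty_expi (E := E) k) f

theorem coeffL_apply (f : L2 E) (n : ℤ) : coeffL E n f = fourierCoeff f n := rfl

theorem coeffL_mulExp (k n : ℤ) (f : L2 E) : coeffL E n (mulExp k f) = coeffL E (n - k) f := by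
  rw [coeffL_apply, coeffL_apply, fourierCoeff_congr_ae (mulExp_coeFn k f)]
  refine integral_congr_ae (ae_of_all _ fun t => ?_)
  change expi (-n) t • expi k t • f t = expi (-(n - k)) t • f t
  rw [smul_smul, expi_mul]
  congr 2
  ring

theorem mulExp_mulExp (k l : ℤ) (f : L2 E) : mulExp k (mulExp l f) = mulExp (k + l) f := by
  refine Lp.ext ?_
  filter_upwards [mulExp_coeFn k (mulExp l f), mulExp_coeFn l f, mulExp_coeFn (k + l) f]
    with t h1 h2 h3
  rw [h1, h2, h3, smul_smul, expi_mul]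

theorem mulExp_zero (f : L2 E) : mulExp 0 f = f := by
  refine Lp.ext ?_
  filter_upwards [mulExp_coeFn 0 f] with t h1
  rw [h1]
  simp [expi]

/-- The function `e^{int} a`. -/
noncomputable def mono (n : ℤ) : E →ₗᵢ[ℂ] L2 E where
  toLinearMap := (mulExp n).toLinearMap ∘ₗ (Lp.constL 2 μ𝕋 ℂ : E →L[ℂ] L2 E)
  norm_map' a := by
    change ‖mulExp n (Lp.const 2 μ𝕋 a)‖ = ‖a‖
    rw [LinearIsometry.norm_map]
    refine (Lp.norm_const' 2 μ𝕋 a (by norm_num) (by norm_num)).trans ?_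
    simp

theorem mono_coeFn (n : ℤ) (a : E) : mono n a =ᵐ[μ𝕋] fun t => expi n t • a := by
  filter_upwards [mulExp_coeFn n (Lp.const 2 μ𝕋 a), Lp.coeFn_const (p := 2) (μ := μ𝕋) a]
    with t h1 h2
  change mulExp n (Lp.const 2 μ𝕋 a) t = _
  rw [h1, h2]
  rfl

theorem mulExp_mono (k n : ℤ) (a : E) : mulExp k (mono n a) = mono (k + n) a :=
  mulExp_mulExp k n _

theorem mem_H2_iff {f : L2 E} : f ∈ H2 E ↔ ∀ n : ℤ, n < 0 → coeffL E n f = 0 := mem_H2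

variable [CompleteSpace E]

theorem inner_mono_left (n : ℤ) (a : E) (f : L2 E) :
    ⟪mono n a, f⟫_ℂ = ⟪a, coeffL E n f⟫_ℂ := by
  rw [L2.inner_def, coeffL_apply, fourierCoeff, ← integral_inner]
  · refine integral_congr_ae ?_
    filter_upwards [mono_coeFn n a] with t ht
    rw [ht, inner_smul_left, inner_smul_right, fourier_neg]
  · exact (integrable_L2 f).fourier_smul (-n)

theorem coeffL_mono (m n : ℤ) (a : E) : coeffL E m (mono n a) = if m = n then a else 0 := by
  have : ∀ k : ℤ, ∀ b : E,
      fourierCoeff (T := 2 * Real.pi) (fun _ => b) k = if k = 0 then b else 0 := by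
    intro k b
    have h := congrFun (fourierCoeff_fourier (T := 2 * Real.pi) 0) k
    rw [fourierCoeff] at h ⊢
    simp only [fourier_zero, smul_eq_mul, mul_one] at h
    rw [integral_smul_const, h]
    by_cases hk : k = 0 <;> simp [hk]
  have h0 : mono n a = mulExp n (mono 0 a) := by rw [mulExp_mono, add_zero]
  have h1 : ⇑(mono 0 a : L2 E) =ᵐ[μ𝕋] fun _ => a := by
    filter_upwards [mono_coeFn 0 a] with t ht
    rw [ht]; simp [expi]
  rw [h0, coeffL_mulExp, coeffL_apply, fourierCoeff_congr_ae h1, this]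
  simp [sub_eq_zero]

theorem mono_mem_H2 {n : ℤ} (hn : 0 ≤ n) (a : E) : mono n a ∈ H2 E := by
  rw [mem_H2_iff]
  intro m hm
  rw [coeffL_mono, if_neg (by omega)]

theorem orthogonalFamily_mono : OrthogonalFamily ℂ (fun _ : ℤ => E) (fun n => mono n) := by
  intro m n hmn a b
  rw [inner_mono_left, coeffL_mono, if_neg hmn, inner_zero_right]

/-- Bessel's inequality: the partial Fourier sum g satisfies ⟪g, f⟫ = ‖g‖², and Cauchy–Schwarz
finishes. -/
theorem sum_norm_sq_coeffL_le (s : Finset ℤ) (f : L2 E) :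
    ∑ n ∈ s, ‖coeffL E n f‖ ^ 2 ≤ ‖f‖ ^ 2 := by
  set g : L2 E := ∑ n ∈ s, mono n (coeffL E n f) with hg
  have h1 : ‖g‖ ^ 2 = ∑ n ∈ s, ‖coeffL E n f‖ ^ 2 :=
    orthogonalFamily_mono.norm_sum (fun n => coeffL E n f) s
  have h2 : ⟪g, f⟫_ℂ = ((‖g‖ ^ 2 : ℝ) : ℂ) := by
    rw [h1, hg, sum_inner]
    push_cast
    refine Finset.sum_congr rfl fun n _ => ?_
    rw [inner_mono_left, inner_self_eq_norm_sq_to_K]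
    rfl
  have h3 : ‖g‖ ^ 2 ≤ ‖g‖ * ‖f‖ := by
    have := norm_inner_le_norm (𝕜 := ℂ) g f
    rwa [h2, Complex.norm_real, Real.norm_of_nonneg (by positivity)] at this
  rw [← h1]
  nlinarith [norm_nonneg g, norm_nonneg f, sq_nonneg (‖f‖ - ‖g‖)]

variable [TopologicalSpace.SeparableSpace E]

/-- Reduces to scalar functions: each ⟪a, f⟫ has vanishing Fourier coefficients, and separability of
E lets the exceptional null sets for all a be merged into one. -/
theorem eq_zero_of_coeffL_eq_zero {f : L2 E} (hf : ∀ n, coeffL E n f = 0) : f = 0 := by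
  have : SecondCountableTopology E := UniformSpace.secondCountable_of_separable E
  refine Lp.ext ?_
  refine EventuallyEq.trans ?_ (Lp.coeFn_zero E 2 μ𝕋).symm
  refine ae_eq_zero_of_forall_inner (𝕜 := ℂ) fun a => ?_
  set g : L2 ℂ := (innerSL ℂ a).compLp f
  have hg : ⇑g =ᵐ[μ𝕋] fun t => ⟪a, f t⟫_ℂ := (innerSL ℂ a).coeFn_compLp f
  have h0 : g = 0 := by
    apply fourierBasis.repr.injective
    ext n
    rw [fourierBasis_repr, fourierCoeff_congr_ae hg, map_zero]
    have h := integral_inner (𝕜 := ℂ) ((integrable_L2 f).fourier_smul (-n)) a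
    have h' : ⟪a, coeffL E n f⟫_ℂ = 0 := by rw [hf n, inner_zero_right]
    rw [coeffL_apply, fourierCoeff, ← h] at h'
    simp only [inner_smul_right] at h'
    exact h'
  rw [h0] at hg
  exact hg.symm.trans (Lp.coeFn_zero ℂ 2 μ𝕋)

theorem L2_ext {f g : L2 E} (h : ∀ n, coeffL E n f = coeffL E n g) : f = g := by
  rw [← sub_eq_zero]
  exact eq_zero_of_coeffL_eq_zero fun n => by rw [map_sub, h n, sub_self]

theorem hasSum_mono (f : L2 E) : HasSum (fun n : ℤ => mono n (coeffL E n f)) f := by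
  have hV : IsHilbertSum ℂ (fun _ : ℤ => E) (fun n => (mono n : E →ₗᵢ[ℂ] L2 E)) := by
    refine IsHilbertSum.mk orthogonalFamily_mono ?_
    rw [← Submodule.orthogonal_orthogonal_eq_closure, top_le_iff, Submodule.orthogonal_eq_top_iff,
      Submodule.eq_bot_iff]
    intro f hf
    refine eq_zero_of_coeffL_eq_zero fun n => ?_
    have h := hf (mono n (coeffL E n f)) (Submodule.mem_iSup_of_mem n ⟨_, rfl⟩)
    rwa [inner_mono_left, inner_self_eq_zero] at h
  have h := hV.hasSum_linearIsometryEquiv_symm (hV.linearIsometryEquiv f)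
  rw [LinearIsometryEquiv.symm_apply_apply] at h
  convert h using 2 with n
  have h1 := h.mapL (coeffL E n)
  congr 1
  refine h1.unique ?_
  convert hasSum_single n fun m hm => ?_ using 1
  · simp [coeffL_mono]
  · simp [coeffL_mono, hm.symm]

theorem hasSum_inner_coeffL (f g : L2 E) :
    HasSum (fun n : ℤ => ⟪coeffL E n f, coeffL E n g⟫_ℂ) ⟪f, g⟫_ℂ := by
  have h := (hasSum_mono g).mapL (innerSL ℂ f)
  refine h.congr_fun fun n => ?_
  rw [innerSL_apply_apply, ← inner_conj_symm f, inner_mono_left, inner_conj_symm]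

theorem mem_H2_orthogonal_iff {f : L2 E} :
    f ∈ (H2 E)ᗮ ↔ ∀ n : ℤ, 0 ≤ n → coeffL E n f = 0 := by
  constructor
  · intro hf n hn
    have h := hf _ (mono_mem_H2 hn (coeffL E n f))
    rwa [inner_mono_left, inner_self_eq_zero] at h
  · intro hf g hg
    refine (hasSum_inner_coeffL g f).unique ?_
    convert hasSum_zero using 2 with n
    rcases lt_or_ge n 0 with hn | hn
    · rw [mem_H2_iff.mp hg n hn, inner_zero_left]
    · rw [hf n hn, inner_zero_right]

end Fourier

/-! ### Partial isometries -/

section PartialIsometry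

variable {H : Type*} [NormedAddCommGroup H] [InnerProductSpace ℂ H] [CompleteSpace H]
variable {K : Type*} [NormedAddCommGroup K] [InnerProductSpace ℂ K] [CompleteSpace K]

theorem adjoint_mem_ker_orthogonal (T : H →L[ℂ] K) (y : K) :
    (T†) y ∈ (LinearMap.ker (T : H →ₗ[ℂ] K))ᗮ := by
  intro x hx
  have hx' : T x = 0 := hx
  rw [adjoint_inner_right, hx', inner_zero_left]

/-- T* maps into M = (ker T)ᗮ, and polarization of the isometry T on M gives T*T = 1 on M. The
algebraic form T T* T = T passes to adjoints. -/
theorem isPartialIsometry_iff (T : H →L[ℂ] K) :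
    IsPartialIsometry T ↔ ∀ x, T ((T†) (T x)) = T x := by
  constructor
  · intro h x
    set M := (LinearMap.ker (T : H →ₗ[ℂ] K))ᗮ with hM
    let I : M →ₗᵢ[ℂ] K := ⟨(T : H →ₗ[ℂ] K) ∘ₗ M.subtype, fun x => h x x.2⟩
    have key : ∀ x ∈ M, (T†) (T x) = x := by
      intro x hx
      have hd : (T†) (T x) - x ∈ M := M.sub_mem (adjoint_mem_ker_orthogonal T _) hx
      have h0 : ⟪(T†) (T x) - x, (T†) (T x) - x⟫_ℂ = 0 := by
        have h1 := I.inner_map_map ⟨_, hd⟩ ⟨x, hx⟩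
        change ⟪T ((T†) (T x) - x), T x⟫_ℂ = ⟪(T†) (T x) - x, x⟫_ℂ at h1
        rw [inner_sub_right, adjoint_inner_right, h1, sub_self]
      exact sub_eq_zero.mp (inner_self_eq_zero.mp h0)
    have hker : IsClosed (LinearMap.ker (T : H →ₗ[ℂ] K) : Set H) := T.isClosed_ker
    have : CompleteSpace (LinearMap.ker (T : H →ₗ[ℂ] K)) := hker.completeSpace_coe
    obtain ⟨y, hy, z, hz, hyz⟩ := (LinearMap.ker (T : H →ₗ[ℂ] K)).exists_add_mem_mem_orthogonal x
    have hy' : T y = 0 := hy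
    rw [hyz, map_add, hy', zero_add, key z hz]
  · intro h x hx
    have h1 : x - (T†) (T x) = 0 := by
      refine inner_self_eq_zero.mp (Submodule.inner_right_of_mem_orthogonal
        (K := LinearMap.ker (T : H →ₗ[ℂ] K)) ?_
        (Submodule.sub_mem _ hx (adjoint_mem_ker_orthogonal T _)))
      change T (x - (T†) (T x)) = 0
      rw [map_sub, h, sub_self]
    have h2 : ‖T x‖ ^ 2 = ‖x‖ ^ 2 := by
      rw [← inner_self_eq_norm_sq (𝕜 := ℂ), ← inner_self_eq_norm_sq (𝕜 := ℂ),
        ← adjoint_inner_right, ← sub_eq_zero.mp h1]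
    exact (sq_eq_sq₀ (norm_nonneg _) (norm_nonneg _)).mp h2

theorem IsPartialIsometry.adjoint {T : H →L[ℂ] K} (hT : IsPartialIsometry T) :
    IsPartialIsometry (T†) := by
  rw [isPartialIsometry_iff] at hT ⊢
  have h : T ∘L (T†) ∘L T = T := ext hT
  intro x
  have h' := congrArg (fun A : H →L[ℂ] K => (A†) x) h
  simpa using h'

theorem IsPartialIsometry.norm_apply_le {T : H →L[ℂ] K} (hT : IsPartialIsometry T) (x : H) :
    ‖T x‖ ≤ ‖x‖ := by
  rw [isPartialIsometry_iff] at hT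
  have h1 : ‖(T†) (T x)‖ ^ 2 = ‖T x‖ ^ 2 := by
    rw [← inner_self_eq_norm_sq (𝕜 := ℂ), ← inner_self_eq_norm_sq (𝕜 := ℂ),
      adjoint_inner_left, hT]
  have h2 : ‖(T†) (T x)‖ = ‖T x‖ := (sq_eq_sq₀ (norm_nonneg _) (norm_nonneg _)).mp h1
  have h3 : ‖T x‖ ^ 2 ≤ ‖T x‖ * ‖x‖ := by
    have h4 : ‖⟪(T†) (T x), x⟫_ℂ‖ ≤ _ := norm_inner_le_norm _ _
    rw [adjoint_inner_left, inner_self_eq_norm_sq_to_K, h2] at h4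
    simpa using h4
  nlinarith [norm_nonneg (T x), norm_nonneg x, sq_nonneg (‖x‖ - ‖T x‖)]

end PartialIsometry

/-! ### Orthogonal series and bounded power series -/

section Sums

variable {F : Type*} [NormedAddCommGroup F] [InnerProductSpace ℂ F] [CompleteSpace F]

theorem summable_of_pairwise_orthogonal {ι : Type*} {x : ι → F}
    (hx : Pairwise fun i j => ⟪x i, x j⟫_ℂ = 0) (hs : Summable fun i => ‖x i‖ ^ 2) :
    Summable x := by
  have hV : OrthogonalFamily ℂ (fun i => (ℂ ∙ x i)) fun i => (ℂ ∙ x i).subtypeₗᵢ := by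
    refine OrthogonalFamily.of_pairwise fun i j hij => ?_
    rw [Function.onFun, Submodule.isOrtho_span]
    rintro u rfl v rfl
    exact hx hij
  exact (hV.summable_iff_norm_sq_summable
    (fun i => ⟨x i, Submodule.mem_span_singleton_self _⟩)).2 hs

omit [CompleteSpace F] in
theorem hasSum_inner_of_pairwise_orthogonal {ι : Type*} {x y : ι → F} {s s' : F}
    (hxy : Pairwise fun i j => ⟪x i, y j⟫_ℂ = 0) (hx : HasSum x s) (hy : HasSum y s') :
    HasSum (fun i => ⟪x i, y i⟫_ℂ) ⟪s, s'⟫_ℂ := by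
  have h1 : ∀ i, ⟪x i, y i⟫_ℂ = ⟪x i, s'⟫_ℂ := fun i =>
    ((hasSum_single i fun j hj => hxy hj.symm)).unique (hy.mapL (innerSL ℂ (x i)))
  have h2 := (hx.mapL (innerSL ℂ s')).star
  simp only [innerSL_apply_apply] at h2
  rw [show ⟪s, s'⟫_ℂ = star ⟪s', s⟫_ℂ from (inner_conj_symm s s').symm]
  refine h2.congr_fun fun i => ?_
  rw [h1 i]
  exact (inner_conj_symm (x i) s').symm

/-- The coefficients of a bounded power series without constant term are square summable. -/
theorem sum_norm_sq_le_of_power_series {c : ℕ → F} {C K : ℝ} (hc : ∀ m, ‖c m‖ ≤ C) (hK : 0 ≤ K)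
    {Φ : ℂ → F} (hΦ : ∀ z ∈ Metric.ball (0 : ℂ) 1, HasSum (fun m => z ^ (m + 1) • c m) (Φ z))
    (hb : ∀ z ∈ Metric.ball (0 : ℂ) 1, ‖Φ z‖ ≤ K) (s : Finset ℕ) :
    ∑ m ∈ s, ‖c m‖ ^ 2 ≤ K ^ 2 := by
  have hC : 0 ≤ C := (norm_nonneg _).trans (hc 0)
  have key : ∀ r : ℝ, 0 < r → r < 1 → ∑ m ∈ s, ‖((r : ℂ) ^ (m + 1)) • c m‖ ^ 2 ≤ K ^ 2 := by
    intro r hr0 hr1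
    have hball : ∀ t, (r : ℂ) * expi 1 t ∈ Metric.ball (0 : ℂ) 1 := fun t => by
      rw [mem_ball_zero_iff, norm_mul, norm_expi, mul_one, Complex.norm_real,
        Real.norm_of_nonneg hr0.le]
      exact hr1
    let g : ℕ → C(𝕋, F) := fun m =>
      ⟨fun t => ((r : ℂ) * expi 1 t) ^ (m + 1) • c m, by
        have := (fourier (T := 2 * Real.pi) 1).continuous
        fun_prop⟩
    have hg : ∀ m t, g m t = ((r : ℂ) * expi 1 t) ^ (m + 1) • c m := fun _ _ => rfl
    have hgn : ∀ m, ‖g m‖ ≤ r ^ m * C := by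
      intro m
      refine (ContinuousMap.norm_le _ (by positivity)).2 fun t => ?_
      rw [hg, norm_smul, norm_pow, norm_mul, norm_expi, mul_one, Complex.norm_real,
        Real.norm_of_nonneg hr0.le]
      exact mul_le_mul (pow_le_pow_of_le_one hr0.le hr1.le (Nat.le_succ m)) (hc m)
        (norm_nonneg _) (by positivity)
    have hsum : Summable g :=
      Summable.of_norm_bounded ((summable_geometric_of_lt_one hr0.le hr1).mul_right C) hgn
    -- G is t ↦ Φ(r e^{it}): bounded by K, with (m+1)-th Fourier coefficient r^{m+1} c_m. Bessel's
    -- inequality for G is the claim at radius r.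
    set G : L2 F := ContinuousMap.toLp (E := F) 2 μ𝕋 ℂ (∑' m, g m) with hG
    have hGsum : HasSum (fun m : ℕ => (mono ((m : ℤ) + 1) ((r : ℂ) ^ (m + 1) • c m) : L2 F)) G := by
      refine (hsum.hasSum.mapL (ContinuousMap.toLp (E := F) 2 μ𝕋 ℂ)).congr_fun fun m => ?_
      refine Lp.ext ?_
      filter_upwards [mono_coeFn ((m : ℤ) + 1) ((r : ℂ) ^ (m + 1) • c m),
        ContinuousMap.coeFn_toLp (p := 2) (𝕜 := ℂ) μ𝕋 (g m)] with t h1 h2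
      rw [h1, h2, hg, mul_pow, smul_smul, mul_comm, expi_one_pow]
    have hGn : ‖G‖ ≤ K := by
      refine (Lp.norm_le_of_ae_bound (C := K) hK ?_).trans (le_of_eq ?_)
      · filter_upwards [ContinuousMap.coeFn_toLp (p := 2) (𝕜 := ℂ) μ𝕋 (∑' m, g m)] with t ht
        rw [ht]
        have h1 := hsum.hasSum.mapL (ContinuousMap.evalCLM ℂ t)
        rw [show (∑' m, g m) t = Φ ((r : ℂ) * expi 1 t) from h1.unique (hΦ _ (hball t))]
        exact hb _ (hball t)
      · simp [measureUnivNNReal]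
    have hGc : ∀ m : ℕ, coeffL F ((m : ℤ) + 1) G = (r : ℂ) ^ (m + 1) • c m := by
      intro m
      refine (hGsum.mapL (coeffL F ((m : ℤ) + 1))).unique ?_
      have h1 : ∀ k : ℕ, k ≠ m →
          coeffL F ((m : ℤ) + 1) (mono ((k : ℤ) + 1) ((r : ℂ) ^ (k + 1) • c k)) = 0 :=
        fun k hk => by rw [coeffL_mono, if_neg (by omega)]
      convert hasSum_single m h1 using 1
      rw [coeffL_mono, if_pos rfl]
    calc ∑ m ∈ s, ‖((r : ℂ) ^ (m + 1)) • c m‖ ^ 2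
        = ∑ n ∈ s.map ⟨fun m : ℕ => (m : ℤ) + 1, fun a b h => by simpa using h⟩,
            ‖coeffL F n G‖ ^ 2 := by
          rw [Finset.sum_map]
          exact Finset.sum_congr rfl fun m _ => by rw [← hGc m]; rfl
      _ ≤ ‖G‖ ^ 2 := sum_norm_sq_coeffL_le _ _
      _ ≤ K ^ 2 := pow_le_pow_left₀ (norm_nonneg _) hGn 2
  -- Since s is finite, letting r → 1 needs only continuity.
  have hlim : Tendsto (fun r : ℝ => ∑ m ∈ s, ‖((r : ℂ) ^ (m + 1)) • c m‖ ^ 2) (𝓝[<] 1)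
      (𝓝 (∑ m ∈ s, ‖(((1 : ℝ) : ℂ) ^ (m + 1)) • c m‖ ^ 2)) := by
    refine Tendsto.mono_left (Continuous.tendsto ?_ 1) nhdsWithin_le_nhds
    fun_prop
  have := le_of_tendsto hlim (by
    filter_upwards [Ioo_mem_nhdsLT (zero_lt_one' ℝ)] with r hr using key r hr.1 hr.2)
  simpa using this

end Sums

/-! ### Orthogonality of the coefficients, the boundary function and Δ -/

section Boundary

variable {E : Type*} [NormedAddCommGroup E] [InnerProductSpace ℂ E] [CompleteSpace E]
variable {F : Type*} [NormedAddCommGroup F] [InnerProductSpace ℂ F] [CompleteSpace F]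

/-- `Θ(z) = ∑ z ^ (m + 1) η_m` on the disc, where the `η_m` are partial isometries with mutually
orthogonal initial spaces and mutually orthogonal final spaces. -/
structure IsOrthogonalSeries (Θ : ℂ → E →L[ℂ] F) (η : ℕ → E →L[ℂ] F) : Prop where
  hasSum : ∀ z ∈ Metric.ball (0 : ℂ) 1, ∀ a, HasSum (fun m => z ^ (m + 1) • η m a) (Θ z a)
  adjoint_apply_of_ne : ∀ {k m : ℕ}, k ≠ m → ∀ a, ((η k)†) (η m a) = 0
  apply_adjoint_of_ne : ∀ {k m : ℕ}, k ≠ m → ∀ b, η k (((η m)†) b) = 0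
  apply_adjoint_apply : ∀ m a, η m (((η m)†) (η m a)) = η m a
  sum_norm_sq_le : ∀ (s : Finset ℕ) a, ∑ m ∈ s, ‖η m a‖ ^ 2 ≤ ‖a‖ ^ 2

/-- η_m is isometric at η_m* b, so the m-th term already exhausts the bound and leaves no room for
the k-th. -/
theorem apply_adjoint_eq_zero_of_sum_norm_sq_le {η : ℕ → E →L[ℂ] F}
    (hη : ∀ m, IsPartialIsometry (η m))
    (hs : ∀ (s : Finset ℕ) a, ∑ m ∈ s, ‖η m a‖ ^ 2 ≤ ‖a‖ ^ 2) {k m : ℕ} (hkm : k ≠ m) (b : F) :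
    η k (((η m)†) b) = 0 := by
  have h1 : ‖η m (((η m)†) b)‖ = ‖((η m)†) b‖ := hη m _ (adjoint_mem_ker_orthogonal _ _)
  have h2 := hs {k, m} (((η m)†) b)
  rw [Finset.sum_pair hkm, h1] at h2
  have h3 : ‖η k (((η m)†) b)‖ ^ 2 = 0 := le_antisymm (by linarith) (by positivity)
  exact norm_eq_zero.mp (pow_eq_zero_iff two_ne_zero |>.mp h3)

theorem isOrthogonalSeries_of_isPartialIsometry {Θ : ℂ → E →L[ℂ] F} {η : ℕ → E →L[ℂ] F}
    (hη : ∀ m, IsPartialIsometry (η m))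
    (hsum : ∀ z ∈ Metric.ball (0 : ℂ) 1, HasSum (fun m => z ^ (m + 1) • η m) (Θ z))
    (hΘ : ∀ z ∈ Metric.ball (0 : ℂ) 1, ∀ a, ‖Θ z a‖ ≤ ‖a‖) : IsOrthogonalSeries Θ η := by
  have hs : ∀ z ∈ Metric.ball (0 : ℂ) 1, ∀ a, HasSum (fun m => z ^ (m + 1) • η m a) (Θ z a) :=
    fun z hz a => (hsum z hz).mapL (ContinuousLinearMap.apply ℂ F a)
  -- The function z ↦ Θ(z̄)* is analytic and contractive with coefficients η_m*; it yields the
  -- orthogonality of the final spaces.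
  have hs' : ∀ z ∈ Metric.ball (0 : ℂ) 1, ∀ b,
      HasSum (fun m => z ^ (m + 1) • ((η m)†) b) (((Θ (star z))†) b) := by
    intro z hz b
    have hz' : star z ∈ Metric.ball (0 : ℂ) 1 := by simpa using hz
    have h1 := (hsum _ hz').map (adjoint : (E →L[ℂ] F) ≃ₗᵢ⋆[ℂ] _)
      (adjoint : (E →L[ℂ] F) ≃ₗᵢ⋆[ℂ] _).continuous
    refine (h1.mapL (ContinuousLinearMap.apply ℂ E b)).congr_fun fun m => ?_
    simp [map_smulₛₗ adjoint]
  have hb : ∀ (s : Finset ℕ) a, ∑ m ∈ s, ‖η m a‖ ^ 2 ≤ ‖a‖ ^ 2 := fun s a =>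
    sum_norm_sq_le_of_power_series (fun m => (hη m).norm_apply_le a) (norm_nonneg a)
      (fun z hz => hs z hz a) (fun z hz => hΘ z hz a) s
  have hb' : ∀ (s : Finset ℕ) b, ∑ m ∈ s, ‖((η m)†) b‖ ^ 2 ≤ ‖b‖ ^ 2 := fun s b =>
    sum_norm_sq_le_of_power_series (fun m => (hη m).adjoint.norm_apply_le b) (norm_nonneg b)
      (fun z hz => hs' z hz b) (fun z hz => by
        have h1 : ‖Θ (star z)‖ ≤ 1 := opNorm_le_bound _ zero_le_one fun a => by
          simpa using hΘ (star z) (by simpa using hz) a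
        have h2 : ‖(Θ (star z))†‖ ≤ 1 := by simpa using h1
        simpa using le_of_opNorm_le _ h2 b) s
  refine ⟨hs, fun hkm a => ?_, fun hkm b => apply_adjoint_eq_zero_of_sum_norm_sq_le hη hb hkm b,
    fun m a => (isPartialIsometry_iff (η m)).mp (hη m) a, hb⟩
  simpa using apply_adjoint_eq_zero_of_sum_norm_sq_le (fun m => (hη m).adjoint) hb' hkm a

namespace IsOrthogonalSeries

variable {Θ : ℂ → E →L[ℂ] F} {η : ℕ → E →L[ℂ] F} (h : IsOrthogonalSeries Θ η)
include h

theorem inner_apply_of_ne {k m : ℕ} (hkm : k ≠ m) (a b : E) : ⟪η k a, η m b⟫_ℂ = 0 := by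
  rw [← adjoint_inner_right, h.adjoint_apply_of_ne hkm, inner_zero_right]

theorem inner_smul_apply_of_ne {k m : ℕ} (hkm : k ≠ m) (c d : ℂ) (a b : E) :
    ⟪c • η k a, d • η m b⟫_ℂ = 0 := by
  rw [inner_smul_left, inner_smul_right, h.inner_apply_of_ne hkm, mul_zero, mul_zero]

theorem summable_norm_sq (a : E) : Summable fun m => ‖η m a‖ ^ 2 :=
  summable_of_sum_le (fun _ => by positivity) fun s => h.sum_norm_sq_le s a

theorem summable_smul {c : ℕ → ℂ} (hc : ∀ m, ‖c m‖ ≤ 1) (a : E) :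
    Summable fun m => c m • η m a := by
  refine summable_of_pairwise_orthogonal (fun i j hij => ?_) ?_
  · exact h.inner_smul_apply_of_ne hij _ _ a a
  · refine Summable.of_nonneg_of_le (fun _ => by positivity) (fun m => ?_) (h.summable_norm_sq a)
    rw [norm_smul]
    exact pow_le_pow_left₀ (by positivity) (mul_le_of_le_one_left (norm_nonneg _) (hc m)) 2

theorem hasSum_norm_sq {c : ℕ → ℂ} {a : E} {s : F} (hs : HasSum (fun m => c m • η m a) s) :
    HasSum (fun m => ‖c m‖ ^ 2 * ‖η m a‖ ^ 2) (‖s‖ ^ 2) := by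
  have h1 := hasSum_inner_of_pairwise_orthogonal (fun i j hij =>
    h.inner_smul_apply_of_ne hij _ _ a a) hs hs
  have h2 := h1.mapL Complex.reCLM
  have h3 : ∀ x : F, Complex.reCLM ⟪x, x⟫_ℂ = ‖x‖ ^ 2 := inner_self_eq_norm_sq (𝕜 := ℂ)
  simp only [h3, norm_smul, mul_pow] at h2
  exact h2

/-- By orthogonality the squared distance to the limit is ∑ (1 - r^{m+1})² ‖η_m a‖², which tends to
0 by domination by ∑ ‖η_m a‖². -/
theorem tendsto_radial (t : 𝕋) (a : E) :
    Tendsto (fun r : ℝ => Θ ((r : ℂ) * expi 1 t) a) (𝓝[<] 1)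
      (𝓝 (∑' m : ℕ, expi 1 t ^ (m + 1) • η m a)) := by
  have hsm : Summable fun m : ℕ => expi 1 t ^ (m + 1) • η m a :=
    h.summable_smul (fun m => by rw [norm_pow, norm_expi, one_pow]) a
  set s := ∑' m : ℕ, expi 1 t ^ (m + 1) • η m a
  have hr : ∀ᶠ r : ℝ in 𝓝[<] 1, 0 < r ∧ r < 1 := Ioo_mem_nhdsLT zero_lt_one
  have hsq : ∀ᶠ r : ℝ in 𝓝[<] 1, ∑' m : ℕ, (1 - r ^ (m + 1)) ^ 2 * ‖η m a‖ ^ 2 =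
      ‖Θ ((r : ℂ) * expi 1 t) a - s‖ ^ 2 := by
    filter_upwards [hr] with r hr
    have hz : (r : ℂ) * expi 1 t ∈ Metric.ball (0 : ℂ) 1 := by
      rw [mem_ball_zero_iff, norm_mul, norm_expi, mul_one, Complex.norm_real,
        Real.norm_of_nonneg hr.1.le]
      exact hr.2
    have h1 := (h.hasSum _ hz a).sub hsm.hasSum
    simp only [← sub_smul] at h1
    rw [← (h.hasSum_norm_sq h1).tsum_eq]
    refine tsum_congr fun m => ?_
    congr 2
    have e : ((r : ℂ) * expi 1 t) ^ (m + 1) - expi 1 t ^ (m + 1) =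
        ((r ^ (m + 1) - 1 : ℝ) : ℂ) * expi 1 t ^ (m + 1) := by
      push_cast; ring
    rw [e, norm_mul, norm_pow, norm_expi, one_pow, mul_one, Complex.norm_real, norm_sub_rev,
      Real.norm_of_nonneg (sub_nonneg.mpr (pow_le_one₀ hr.1.le hr.2.le))]
  have hlim : Tendsto (fun r : ℝ => ∑' m : ℕ, (1 - r ^ (m + 1)) ^ 2 * ‖η m a‖ ^ 2) (𝓝[<] 1)
      (𝓝 (∑' m : ℕ, (1 - (1 : ℝ) ^ (m + 1)) ^ 2 * ‖η m a‖ ^ 2)) := by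
    refine tendsto_tsum_of_dominated_convergence (h.summable_norm_sq a) (fun m => ?_) ?_
    · refine Tendsto.mono_left (Continuous.tendsto ?_ 1) nhdsWithin_le_nhds
      fun_prop
    · filter_upwards [hr] with r hr m
      have h1 : r ^ (m + 1) ≤ 1 := pow_le_one₀ hr.1.le hr.2.le
      have h2 : 0 ≤ r ^ (m + 1) := pow_nonneg hr.1.le _
      rw [Real.norm_of_nonneg (by positivity)]
      exact mul_le_of_le_one_left (by positivity) (pow_le_one₀ (by linarith) (by linarith))
  simp only [one_pow, sub_self, ne_eq, OfNat.ofNat_ne_zero, not_false_eq_true, zero_pow, zero_mul,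
    tsum_zero] at hlim
  rw [tendsto_iff_norm_sub_tendsto_zero]
  have h3 := (hlim.congr' hsq).sqrt
  simpa using h3

theorem isRadialLimit_boundary (t : 𝕋) : IsRadialLimit Θ t (boundary Θ t) := by
  have hex : ∃ A, IsRadialLimit Θ t A := by
    have hlim : Tendsto (fun (N : ℕ) (a : E) =>
        (∑ m ∈ Finset.range N, expi 1 t ^ (m + 1) • η m) a) atTop
        (𝓝 fun a => ∑' m : ℕ, expi 1 t ^ (m + 1) • η m a) := by
      rw [tendsto_pi_nhds]
      intro a
      simpa using (h.summable_smul (c := fun m => expi 1 t ^ (m + 1))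
        (fun m => by rw [norm_pow, norm_expi, one_pow]) a).hasSum.tendsto_sum_nat
    -- Banach–Steinhaus: the pointwise limit of the partial sums is a bounded operator.
    exact ⟨continuousLinearMapOfTendsto _ hlim, h.tendsto_radial t⟩
  rw [boundary, dif_pos hex]
  exact hex.choose_spec

theorem hasSum_boundary (t : 𝕋) (a : E) :
    HasSum (fun m : ℕ => expi ((m : ℤ) + 1) t • η m a) (boundary Θ t a) := by
  have h1 : boundary Θ t a = ∑' m : ℕ, expi 1 t ^ (m + 1) • η m a :=
    tendsto_nhds_unique (h.isRadialLimit_boundary t a) (h.tendsto_radial t a)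
  rw [h1]
  simp only [expi_one_pow]
  exact (h.summable_smul (fun m => (norm_expi _ t).le) a).hasSum

/-- The unimodular factors cancel on the diagonal and the off-diagonal terms vanish, so the terms do
not involve t. This is why Δ is constant. -/
theorem hasSum_inner_boundary (t : 𝕋) (a b : E) :
    HasSum (fun m => ⟪η m a, η m b⟫_ℂ) ⟪boundary Θ t a, boundary Θ t b⟫_ℂ := by
  refine (hasSum_inner_of_pairwise_orthogonal (fun i j hij => ?_)
    (h.hasSum_boundary t a) (h.hasSum_boundary t b)).congr_fun fun m => ?_
  · exact h.inner_smul_apply_of_ne hij _ _ a b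
  · rw [inner_smul_left, inner_smul_right, ← mul_assoc, ← Complex.normSq_eq_conj_mul_self,
      Complex.normSq_eq_norm_sq, norm_expi]
    simp

theorem norm_boundary_apply_le (t : 𝕋) (a : E) : ‖boundary Θ t a‖ ≤ ‖a‖ := by
  have h1 := h.hasSum_norm_sq (h.hasSum_boundary t a)
  simp only [norm_expi, one_pow, one_mul] at h1
  exact (sq_le_sq₀ (norm_nonneg _) (norm_nonneg _)).mp
    (hasSum_le_of_sum_le h1 fun s => h.sum_norm_sq_le s a)

theorem isLInfty_boundary : IsLInfty (boundary Θ) where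
  meas a := by
    refine aestronglyMeasurable_of_tendsto_ae atTop
      (f := fun (N : ℕ) (t : 𝕋) => ∑ m ∈ Finset.range N, expi ((m : ℤ) + 1) t • η m a)
      (fun N => ?_) (ae_of_all _ fun t => (h.hasSum_boundary t a).tendsto_sum_nat)
    refine (continuous_finsetSum _ fun m _ => ?_).aestronglyMeasurable
    exact (fourier ((m : ℤ) + 1)).continuous.smul continuous_const
  bdd := ⟨1, ae_of_all _ fun t => opNorm_le_bound _ zero_le_one fun a => by
    simpa using h.norm_boundary_apply_le t a⟩

theorem adjoint_boundary_comp_boundary (t s : 𝕋) :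
    (boundary Θ t)† ∘L boundary Θ t = (boundary Θ s)† ∘L boundary Θ s := by
  refine ext fun b => ext_inner_left ℂ fun a => ?_
  rw [comp_apply, comp_apply, adjoint_inner_right, adjoint_inner_right]
  exact (h.hasSum_inner_boundary t a b).unique (h.hasSum_inner_boundary s a b)

theorem boundary_adjoint_apply (t : 𝕋) (m : ℕ) (b : F) :
    boundary Θ t (((η m)†) b) = expi ((m : ℤ) + 1) t • η m (((η m)†) b) := by
  refine (h.hasSum_boundary t _).unique (hasSum_single m fun k hk => ?_)
  rw [h.apply_adjoint_of_ne hk, smul_zero]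

theorem adjoint_boundary_apply (t : 𝕋) (m : ℕ) (a : E) :
    ((η m)†) (boundary Θ t a) = expi ((m : ℤ) + 1) t • ((η m)†) (η m a) := by
  have h1 := (h.hasSum_boundary t a).mapL ((η m)†)
  simp only [map_smul] at h1
  refine h1.unique (hasSum_single m fun k hk => ?_)
  rw [h.adjoint_apply_of_ne hk.symm, smul_zero]

theorem boundary_eq_zero_iff (t : 𝕋) (a : E) : boundary Θ t a = 0 ↔ ∀ m, η m a = 0 := by
  constructor
  · intro h0 m
    have h1 := h.hasSum_norm_sq (h.hasSum_boundary t a)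
    rw [h0, norm_zero, zero_pow two_ne_zero, hasSum_zero_iff_of_nonneg (fun m => by positivity)]
      at h1
    have h2 := congrFun h1 m
    simpa only [norm_expi, one_pow, one_mul, Pi.zero_apply, ne_eq, OfNat.ofNat_ne_zero,
      not_false_eq_true, pow_eq_zero_iff, norm_eq_zero] using h2
  · intro h0
    refine (h.hasSum_boundary t a).unique ?_
    simp [h0, hasSum_zero]

omit h in
/-- The constant value of `Δ_Θ`. -/
noncomputable def _root_.PowerPartial.deltaProj (Θ : ℂ → E →L[ℂ] F) : E →L[ℂ] E :=
  1 - (boundary Θ 0)† ∘L boundary Θ 0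

/-- At angle 0 both Θ η_m* and η_m* Θ retain only the m-th term, with factor 1; hence η_m Θ*Θ = η_m
η_m* η_m = η_m. Since 1 - Θ*Θ is also the identity on ⋂ ker η_m, it is idempotent. -/
theorem apply_deltaProj (m : ℕ) (a : E) : η m (deltaProj Θ a) = 0 := by
  have h1 : η m (((boundary Θ 0)†) (boundary Θ 0 a)) = η m a := by
    refine ext_inner_left ℂ fun b => ?_
    rw [← adjoint_inner_left, adjoint_inner_right, h.boundary_adjoint_apply, expi_zero, one_smul,
      ← adjoint_inner_right, h.adjoint_boundary_apply, expi_zero, one_smul, adjoint_inner_left,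
      h.apply_adjoint_apply]
  rw [deltaProj, sub_apply, comp_apply, map_sub, h1]
  simp

theorem deltaProj_apply_eq_self {a : E} (ha : ∀ m, η m a = 0) : deltaProj Θ a = a := by
  rw [deltaProj, sub_apply, comp_apply, (h.boundary_eq_zero_iff 0 a).mpr ha, map_zero, sub_zero,
    one_apply_eq_self]

theorem deltaProj_eq_self_iff (a : E) : deltaProj Θ a = a ↔ ∀ m, η m a = 0 :=
  ⟨fun h1 m => by rw [← h1, h.apply_deltaProj], h.deltaProj_apply_eq_self⟩

theorem isStarProjection_deltaProj : IsStarProjection (deltaProj Θ) where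
  isIdempotentElem := ext fun a =>
    h.deltaProj_apply_eq_self fun m => h.apply_deltaProj m a
  isSelfAdjoint := (IsSelfAdjoint.one _).sub (by
    rw [IsSelfAdjoint, star_eq_adjoint, adjoint_comp, adjoint_adjoint])

theorem delta_eq (t : 𝕋) : delta Θ t = deltaProj Θ := by
  rw [delta, h.adjoint_boundary_comp_boundary t 0]
  exact CFC.sqrt_unique h.isStarProjection_deltaProj.isIdempotentElem
    h.isStarProjection_deltaProj.nonneg

theorem boundary_deltaProj (t : 𝕋) (a : E) : boundary Θ t (deltaProj Θ a) = 0 :=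
  (h.boundary_eq_zero_iff t _).mpr fun m => h.apply_deltaProj m a

theorem isLInfty_delta : IsLInfty (delta Θ) where
  meas a := by simpa only [h.delta_eq] using aestronglyMeasurable_const
  bdd := ⟨‖deltaProj Θ‖, ae_of_all _ fun t => by rw [h.delta_eq]⟩

end IsOrthogonalSeries

end Boundary

/-! ### The Toeplitz operator and the model space -/

section Model

variable {E : Type*} [NormedAddCommGroup E] [InnerProductSpace ℂ E] [CompleteSpace E]
variable {F : Type*} [NormedAddCommGroup F] [InnerProductSpace ℂ F] [CompleteSpace F]

namespace IsOrthogonalSeries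

variable {Θ : ℂ → E →L[ℂ] F} {η : ℕ → E →L[ℂ] F} (h : IsOrthogonalSeries Θ η)
include h

theorem laurent_delta_coeFn (f : L2 E) :
    laurent (delta Θ) f =ᵐ[μ𝕋] fun t => deltaProj Θ (f t) := by
  filter_upwards [laurent_coeFn h.isLInfty_delta f] with t ht
  rw [ht, h.delta_eq]

theorem coeffL_laurent_delta (f : L2 E) (n : ℤ) :
    coeffL E n (laurent (delta Θ) f) = deltaProj Θ (coeffL E n f) := by
  rw [coeffL_apply, coeffL_apply, fourierCoeff_congr_ae (h.laurent_delta_coeFn f), fourierCoeff,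
    fourierCoeff, ← ContinuousLinearMap.integral_comp_comm _ ((integrable_L2 f).fourier_smul (-n))]
  simp only [map_smul]

theorem laurent_boundary_laurent_delta (f : L2 E) :
    laurent (boundary Θ) (laurent (delta Θ) f) = 0 := by
  refine Lp.ext ?_
  filter_upwards [laurent_coeFn h.isLInfty_boundary (laurent (delta Θ) f),
    h.laurent_delta_coeFn f, Lp.coeFn_zero F 2 μ𝕋] with t h1 h2 h3
  rw [h1, h2, h3, h.boundary_deltaProj]
  rfl

theorem laurent_delta_idem (f : L2 E) :
    laurent (delta Θ) (laurent (delta Θ) f) = laurent (delta Θ) f := by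
  refine Lp.ext ?_
  filter_upwards [h.laurent_delta_coeFn (laurent (delta Θ) f), h.laurent_delta_coeFn f]
    with t h1 h2
  rw [h1, h2]
  exact congrArg (fun A : E →L[ℂ] E => A (f t)) h.isStarProjection_deltaProj.isIdempotentElem

theorem inner_deltaProj_left (a b : E) : ⟪deltaProj Θ a, b⟫_ℂ = ⟪a, deltaProj Θ b⟫_ℂ := by
  rw [← adjoint_inner_right, h.isStarProjection_deltaProj.isSelfAdjoint.adjoint_eq]

theorem inner_laurent_delta_left (f g : L2 E) :
    ⟪laurent (delta Θ) f, g⟫_ℂ = ⟪f, laurent (delta Θ) g⟫_ℂ := by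
  rw [L2.inner_def, L2.inner_def]
  refine integral_congr_ae ?_
  filter_upwards [h.laurent_delta_coeFn f, h.laurent_delta_coeFn g] with t h1 h2
  rw [h1, h2, h.inner_deltaProj_left]

theorem inner_laurent_boundary (f g : L2 E) :
    ⟪laurent (boundary Θ) f, laurent (boundary Θ) g⟫_ℂ = ⟪f, g - laurent (delta Θ) g⟫_ℂ := by
  rw [L2.inner_def, L2.inner_def]
  refine integral_congr_ae ?_
  filter_upwards [laurent_coeFn h.isLInfty_boundary f, laurent_coeFn h.isLInfty_boundary g,
    h.laurent_delta_coeFn g, Lp.coeFn_sub g (laurent (delta Θ) g)] with t h1 h2 h3 h4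
  rw [h1, h2, h4, Pi.sub_apply, h3, ← adjoint_inner_right, ← comp_apply,
    h.adjoint_boundary_comp_boundary t 0, deltaProj, sub_apply, one_apply_eq_self, sub_sub_cancel]

/-- Apply Θ(1)* to the series of Θ(1)a; its terms become η_m* η_m a. This splits a into its
components in the initial spaces and in ran Δ. -/
theorem hasSum_adjoint_apply (a : E) :
    HasSum (fun m => ((η m)†) (η m a)) (a - deltaProj Θ a) := by
  have h1 := (h.hasSum_boundary 0 a).mapL ((boundary Θ 0)†)
  simp only [expi_zero, one_smul] at h1
  rw [deltaProj, sub_apply, one_apply_eq_self, sub_sub_cancel, comp_apply]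
  refine h1.congr_fun fun m => ?_
  refine ext_inner_left ℂ fun b => ?_
  rw [adjoint_inner_right, adjoint_inner_right, ← h.apply_adjoint_apply m a,
    ← adjoint_inner_left (η m) _ (boundary Θ 0 b), h.adjoint_boundary_apply, expi_zero, one_smul,
    adjoint_inner_left]

theorem laurent_boundary_mono_adjoint (k : ℤ) (m : ℕ) (b : F) :
    laurent (boundary Θ) (mono k (((η m)†) b)) = mono (k + m + 1) (η m (((η m)†) b)) := by
  refine Lp.ext ?_
  filter_upwards [laurent_coeFn h.isLInfty_boundary (mono k (((η m)†) b)),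
    mono_coeFn k (((η m)†) b), mono_coeFn (k + m + 1) (η m (((η m)†) b))] with t h1 h2 h3
  rw [h1, h2, h3, map_smul, h.boundary_adjoint_apply, smul_smul, expi_mul, add_assoc]

theorem laurent_boundary_mono_deltaProj (k : ℤ) (a : E) :
    laurent (boundary Θ) (mono k (deltaProj Θ a)) = 0 := by
  refine Lp.ext ?_
  filter_upwards [laurent_coeFn h.isLInfty_boundary (mono k (deltaProj Θ a)),
    mono_coeFn k (deltaProj Θ a), Lp.coeFn_zero F 2 μ𝕋] with t h1 h2 h3
  rw [h1, h2, h3, map_smul, h.boundary_deltaProj, smul_zero]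
  rfl

/-- Split a by `hasSum_adjoint_apply`: Θ annihilates the Δ component and acts on the m-th initial
space as e^{i(m+1)t} η_m. -/
theorem hasSum_laurent_boundary_mono (k : ℤ) (a : E) :
    HasSum (fun m : ℕ => (mono (k + m + 1) (η m a) : L2 F)) (laurent (boundary Θ) (mono k a)) := by
  have h1 := ((h.hasSum_adjoint_apply a).mapL (mono k).toContinuousLinearMap).mapL
    (laurent (boundary Θ))
  simp only [LinearIsometry.coe_toContinuousLinearMap, h.laurent_boundary_mono_adjoint,
    h.apply_adjoint_apply, map_sub, h.laurent_boundary_mono_deltaProj, sub_zero] at h1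
  exact h1

theorem coeffL_laurent_boundary_mono (k : ℤ) (m : ℕ) (a : E) :
    coeffL F (k + m + 1) (laurent (boundary Θ) (mono k a)) = η m a := by
  refine ((h.hasSum_laurent_boundary_mono k a).mapL (coeffL F (k + m + 1))).unique ?_
  have h1 : ∀ j : ℕ, j ≠ m → coeffL F (k + m + 1) (mono (k + j + 1) (η j a)) = 0 :=
    fun j hj => by rw [coeffL_mono, if_neg (by omega)]
  convert hasSum_single m h1 using 1
  rw [coeffL_mono, if_pos rfl]

theorem coeffL_laurent_boundary_mono_of_le {k n : ℤ} (hn : n ≤ k) (a : E) :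
    coeffL F n (laurent (boundary Θ) (mono k a)) = 0 := by
  refine ((h.hasSum_laurent_boundary_mono k a).mapL (coeffL F n)).unique ?_
  convert hasSum_zero using 2 with j
  rw [coeffL_mono, if_neg (by omega)]

theorem hasSum_inner_laurent_boundary_mono (k : ℤ) (a : E) (u : L2 F) :
    HasSum (fun m : ℕ => ⟪η m a, coeffL F (k + m + 1) u⟫_ℂ)
      ⟪laurent (boundary Θ) (mono k a), u⟫_ℂ := by
  have h1 := ((h.hasSum_laurent_boundary_mono k a).mapL (innerSL ℂ u)).star
  rw [innerSL_apply_apply, ← starRingEnd_apply, inner_conj_symm] at h1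
  refine h1.congr_fun fun m => ?_
  rw [innerSL_apply_apply, ← starRingEnd_apply, inner_conj_symm, inner_mono_left]

theorem laurent_delta_mem_H2 {f : L2 E} (hf : f ∈ H2 E) : laurent (delta Θ) f ∈ H2 E := by
  rw [mem_H2_iff] at hf ⊢
  intro n hn
  rw [h.coeffL_laurent_delta, hf n hn, map_zero]

variable [TopologicalSpace.SeparableSpace E]

theorem laurent_boundary_mem_H2 {f : L2 E} (hf : f ∈ H2 E) : laurent (boundary Θ) f ∈ H2 F := by
  rw [mem_H2_iff]
  intro n hn
  refine (((hasSum_mono f).mapL (laurent (boundary Θ))).mapL (coeffL F n)).unique ?_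
  convert hasSum_zero using 2 with k
  rcases lt_or_ge k 0 with hk | hk
  · rw [mem_H2_iff.mp hf k hk, map_zero, map_zero, map_zero]
  · exact h.coeffL_laurent_boundary_mono_of_le (by omega) _

theorem laurent_delta_mem_H2_orthogonal {f : L2 E} (hf : f ∈ (H2 E)ᗮ) :
    laurent (delta Θ) f ∈ (H2 E)ᗮ := by
  rw [mem_H2_orthogonal_iff] at hf ⊢
  intro n hn
  rw [h.coeffL_laurent_delta, hf n hn, map_zero]

theorem coe_toeplitz (f : H2 E) :
    (toeplitz (boundary Θ) f : L2 F) = laurent (boundary Θ) f :=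
  congrArg Subtype.val (Submodule.orthogonalProjectionOnto_mem_subspace_eq_self
    (⟨_, h.laurent_boundary_mem_H2 f.2⟩ : H2 F))

/-- On H² the product T_Θ* T_Θ is 1 - Δ, because Δ preserves H², and ΘΔ = 0. -/
theorem isPartialIsometry_toeplitz : IsPartialIsometry (toeplitz (boundary Θ)) := by
  rw [isPartialIsometry_iff]
  intro f
  have h1 : ((toeplitz (boundary Θ))†) (toeplitz (boundary Θ) f) =
      f - ⟨_, h.laurent_delta_mem_H2 f.2⟩ := by
    refine ext_inner_left ℂ fun g => ?_
    rw [adjoint_inner_right, Submodule.coe_inner, Submodule.coe_inner, h.coe_toeplitz,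
      h.coe_toeplitz, h.inner_laurent_boundary]
    rfl
  rw [h1, map_sub, sub_eq_self]
  refine Subtype.ext ?_
  rw [h.coe_toeplitz]
  exact h.laurent_boundary_laurent_delta _

omit h [TopologicalSpace.SeparableSpace E] in
theorem _root_.PowerPartial.mem_graphSpace_orthogonal_iff {x : WithLp 2 (L2 F × L2 E)} :
    x ∈ (graphSpace Θ)ᗮ ↔ ∀ f ∈ H2 E,
      ⟪laurent (boundary Θ) f, x.fst⟫_ℂ + ⟪laurent (delta Θ) f, x.snd⟫_ℂ = 0 := by
  constructor
  · intro hx f hf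
    exact hx _ ⟨f, hf, rfl⟩
  · rintro hx _ ⟨f, hf, rfl⟩
    exact hx f hf

omit [TopologicalSpace.SeparableSpace E] in
theorem mem_closure_range_laurent_delta_iff {g : L2 E} :
    g ∈ (LinearMap.range (laurent (delta Θ) : L2 E →ₗ[ℂ] L2 E)).topologicalClosure ↔
      laurent (delta Θ) g = g := by
  have h1 : IsClosed {g : L2 E | laurent (delta Θ) g = g} :=
    isClosed_eq (laurent (delta Θ)).continuous continuous_id
  constructor
  · intro hg
    refine closure_minimal ?_ h1 hg
    rintro _ ⟨f, rfl⟩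
    exact h.laurent_delta_idem f
  · intro hg
    exact Submodule.le_topologicalClosure _ ⟨g, hg⟩

-- Orthogonality to the graph decouples: for f in H² both Δf and f - Δf are in H², the first killed
-- by Θ and the second by Δ. Testing on them separates the two components.
omit [TopologicalSpace.SeparableSpace E] in
theorem mem_modelSpace_iff {x : WithLp 2 (L2 F × L2 E)} :
    x ∈ modelSpace Θ ↔ (x.fst ∈ H2 F ∧ ∀ f ∈ H2 E, ⟪laurent (boundary Θ) f, x.fst⟫_ℂ = 0) ∧
      laurent (delta Θ) x.snd = x.snd ∧ x.snd ∈ (H2 E)ᗮ := by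
  have h0 : x ∈ modelSpace Θ ↔ (x.fst ∈ H2 F ∧
      x.snd ∈ (LinearMap.range (laurent (delta Θ) : L2 E →ₗ[ℂ] L2 E)).topologicalClosure) ∧
      x ∈ (graphSpace Θ)ᗮ := Iff.rfl
  rw [h0, h.mem_closure_range_laurent_delta_iff, mem_graphSpace_orthogonal_iff]
  constructor
  · rintro ⟨⟨h1, h2⟩, h3⟩
    refine ⟨⟨h1, fun f hf => ?_⟩, h2, fun f hf => ?_⟩
    · have h4 := h3 _ (sub_mem hf (h.laurent_delta_mem_H2 hf))
      rwa [map_sub, map_sub, h.laurent_boundary_laurent_delta, h.laurent_delta_idem, sub_zero,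
        sub_self, inner_zero_left, add_zero] at h4
    · have h4 := h3 _ (h.laurent_delta_mem_H2 hf)
      rwa [h.laurent_boundary_laurent_delta, h.laurent_delta_idem, inner_zero_left, zero_add,
        h.inner_laurent_delta_left, h2] at h4
  · rintro ⟨⟨h1, h2⟩, h3, h4⟩
    refine ⟨⟨h1, h3⟩, fun f hf => ?_⟩
    rw [h2 f hf, zero_add, h.inner_laurent_delta_left, h3]
    exact h4 f hf

/-- As T_Θ is a partial isometry, 1 - T_Θ T_Θ* is the projection onto ker T_Θ*, which is the space
of admissible first components. -/
theorem coe_modelSpace_eq :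
    (modelSpace Θ : Set (WithLp 2 (L2 F × L2 E))) =
      {x | ∃ f : H2 F, ∃ g ∈ (H2 E)ᗮ,
        x = WithLp.toLp 2
          (((f - toeplitz (boundary Θ) (((toeplitz (boundary Θ))†) f) : H2 F) : L2 F),
            laurent (delta Θ) g)} := by
  ext x
  rw [SetLike.mem_coe, h.mem_modelSpace_iff]
  constructor
  · rintro ⟨⟨h1, h2⟩, h3, h4⟩
    have h5 : ((toeplitz (boundary Θ))†) (⟨x.fst, h1⟩ : H2 F) = 0 := by
      refine ext_inner_left ℂ fun g => ?_
      rw [adjoint_inner_right, inner_zero_right, Submodule.coe_inner, h.coe_toeplitz]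
      exact h2 g g.2
    refine ⟨⟨x.fst, h1⟩, x.snd, h4, ?_⟩
    rw [h5, map_zero, sub_zero, h3]
    rfl
  · rintro ⟨f, g, hg, rfl⟩
    refine ⟨⟨(f - toeplitz (boundary Θ) (((toeplitz (boundary Θ))†) f)).2, fun e he => ?_⟩, h.laurent_delta_idem g,
      h.laurent_delta_mem_H2_orthogonal hg⟩
    rw [← show (toeplitz (boundary Θ) ⟨e, he⟩ : L2 F) = laurent (boundary Θ) e from
      h.coe_toeplitz ⟨e, he⟩]
    change ⟪toeplitz (boundary Θ) ⟨e, he⟩,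
      f - toeplitz (boundary Θ) (((toeplitz (boundary Θ))†) f)⟫_ℂ = 0
    have h2 := (isPartialIsometry_iff _).mp h.isPartialIsometry_toeplitz.adjoint f
    rw [adjoint_adjoint] at h2
    rw [← adjoint_inner_right, map_sub, h2, sub_self, inner_zero_right]

theorem mem_modelSpace_iff_coeffL {x : WithLp 2 (L2 F × L2 E)} :
    x ∈ modelSpace Θ ↔ ((∀ n : ℤ, n < 0 → coeffL F n x.fst = 0) ∧
        ∀ k m : ℕ, ((η m)†) (coeffL F (k + m + 1) x.fst) = 0) ∧
      (∀ n m, η m (coeffL E n x.snd) = 0) ∧ ∀ n : ℤ, 0 ≤ n → coeffL E n x.snd = 0 := by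
  rw [h.mem_modelSpace_iff, mem_H2_iff, mem_H2_orthogonal_iff]
  refine and_congr (and_congr Iff.rfl ⟨fun h1 k m => ?_, fun h1 f hf => ?_⟩)
    (and_congr ⟨fun h1 n => ?_, fun h1 => ?_⟩ Iff.rfl)
  -- With c = û(k+m+1), the test function e^{ikt} η_m* c is sent by Θ to e^{i(k+m+1)t} η_m η_m* c,
  -- whose inner product with u is ‖η_m* c‖².
  · have h2 := h1 _ (mono_mem_H2 (Int.natCast_nonneg k)
      (((η m)†) (coeffL F (k + m + 1) x.fst)))
    rwa [h.laurent_boundary_mono_adjoint, inner_mono_left, ← adjoint_inner_right,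
      inner_self_eq_zero] at h2
  · have h2 := ((hasSum_mono f).mapL (laurent (boundary Θ))).mapL (innerSL ℂ x.fst)
    rw [← inner_conj_symm, map_eq_zero]
    refine h2.unique ?_
    convert hasSum_zero using 2 with k
    rcases lt_or_ge k 0 with hk | hk
    · rw [mem_H2_iff.mp hf k hk, map_zero, map_zero, map_zero]
    · lift k to ℕ using hk
      rw [innerSL_apply_apply, ← inner_conj_symm, map_eq_zero]
      refine (h.hasSum_inner_laurent_boundary_mono k _ x.fst).unique ?_
      convert hasSum_zero using 2 with m
      rw [← adjoint_inner_right, h1 k m, inner_zero_right]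
  · rw [← h.deltaProj_eq_self_iff, ← h.coeffL_laurent_delta, h1]
  · refine L2_ext fun n => ?_
    rw [h.coeffL_laurent_delta, h.deltaProj_apply_eq_self (h1 n)]

end IsOrthogonalSeries

end Model

/-! ### Defect spaces and characteristic functions via isometries -/

section Coincide

variable {E : Type*} [NormedAddCommGroup E] [InnerProductSpace ℂ E] [CompleteSpace E]
variable {F : Type*} [NormedAddCommGroup F] [InnerProductSpace ℂ F] [CompleteSpace F]
variable {H : Type*} [NormedAddCommGroup H] [InnerProductSpace ℂ H] [CompleteSpace H]

theorem adjoint_apply_isometry (V : E →ₗᵢ[ℂ] H) (a : E) :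
    (V.toContinuousLinearMap†) (V a) = a := by
  refine ext_inner_left ℂ fun b => ?_
  rw [adjoint_inner_right]
  exact V.inner_map_map b a

theorem defectOp_eq_of_isometry {T : H →L[ℂ] H} {V : E →ₗᵢ[ℂ] H}
    (hV : 1 - (T†) * T = V.toContinuousLinearMap ∘L (V.toContinuousLinearMap†)) :
    defectOp T = V.toContinuousLinearMap ∘L (V.toContinuousLinearMap†) := by
  set p := V.toContinuousLinearMap ∘L (V.toContinuousLinearMap†)
  have hp : IsStarProjection p :=
    { isIdempotentElem := ext fun x => congrArg V (adjoint_apply_isometry V _)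
      isSelfAdjoint := by
        rw [IsSelfAdjoint, star_eq_adjoint, adjoint_comp, adjoint_adjoint] }
  rw [defectOp, hV]
  exact CFC.sqrt_unique hp.isIdempotentElem hp.nonneg

theorem defectSpace_eq_range_of_isometry {T : H →L[ℂ] H} {V : E →ₗᵢ[ℂ] H}
    (hV : 1 - (T†) * T = V.toContinuousLinearMap ∘L (V.toContinuousLinearMap†)) :
    defectSpace T = LinearMap.range V.toLinearMap := by
  have h1 : LinearMap.range (defectOp T : H →ₗ[ℂ] H) = LinearMap.range V.toLinearMap := by
    rw [defectOp_eq_of_isometry hV]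
    refine le_antisymm ?_ ?_
    · rintro _ ⟨x, rfl⟩
      exact ⟨(V.toContinuousLinearMap†) x, rfl⟩
    · rintro _ ⟨a, rfl⟩
      exact ⟨V a, congrArg V (adjoint_apply_isometry V a)⟩
  have h2 : IsClosed (LinearMap.range V.toLinearMap : Set H) := by
    exact V.isometry.isClosedEmbedding.isClosed_range
  rw [defectSpace, h1, h2.submodule_topologicalClosure_eq]

/-- The identification of a Hilbert space with the defect space of `T` induced by an isometry
whose range projection is `1 - T* T`. -/
noncomputable def defectEquiv {T : H →L[ℂ] H} {V : E →ₗᵢ[ℂ] H}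
    (hV : 1 - (T†) * T = V.toContinuousLinearMap ∘L (V.toContinuousLinearMap†)) :
    E ≃ₗᵢ[ℂ] defectSpace T :=
  LinearIsometryEquiv.ofSurjective
    ⟨V.toLinearMap.codRestrict (defectSpace T) fun a => by
      rw [defectSpace_eq_range_of_isometry hV]; exact ⟨a, rfl⟩, V.norm_map⟩ (by
      rintro ⟨x, hx⟩
      have hx' := hx
      rw [defectSpace_eq_range_of_isometry hV] at hx'
      obtain ⟨a, rfl⟩ := hx'
      exact ⟨a, rfl⟩)

/-- If the defect operators of `T` are the range projections of isometries `V`, `J`, then the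
characteristic function of `T` is determined by the moments `J* T*ⁿ V`. -/
theorem coincide_charFun {T : H →L[ℂ] H} (hT : IsContraction T) {V : E →ₗᵢ[ℂ] H}
    {J : F →ₗᵢ[ℂ] H}
    (hV : 1 - (T†) * T = V.toContinuousLinearMap ∘L (V.toContinuousLinearMap†))
    (hJ : 1 - ((T†)†) * (T†) = J.toContinuousLinearMap ∘L (J.toContinuousLinearMap†))
    (hTV : ∀ a, T (V a) = 0) {Θ : ℂ → E →L[ℂ] F}
    (hΘ : ∀ z ∈ Metric.ball (0 : ℂ) 1, ∀ a,
      HasSum (fun n : ℕ => z ^ (n + 1) • (J.toContinuousLinearMap†) (((T†) ^ n) (V a))) (Θ z a)) :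
    Coincide (charFun T hT) Θ := by
  have key : ∀ z ∈ Metric.ball (0 : ℂ) 1, ∀ a, charOp T z (V a) = J (Θ z a) := by
    intro z hz a
    have hn : ‖z • (T†)‖ < 1 := by
      have h1 : ‖T†‖ ≤ 1 := opNorm_le_bound _ zero_le_one fun x => by
        simpa using isContraction_adjoint hT x
      rw [norm_smul]
      exact (mul_le_of_le_one_right (norm_nonneg z) h1).trans_lt (mem_ball_zero_iff.mp hz)
    have hinv : HasSum (fun n : ℕ => (z • (T†)) ^ n) (Ring.inverse (1 - z • (T†))) := by
      rw [NormedRing.inverse_one_sub _ hn]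
      exact (summable_geometric_of_norm_lt_one hn).hasSum
    -- Here T V = 0, D_T V = V and D_{T*} = JJ*, so only the Neumann series of (1 - zT*)⁻¹ between V
    -- and J* survives.
    have hs := ((((hinv.mapL (ContinuousLinearMap.apply ℂ H (V a))).mapL
      (J.toContinuousLinearMap†)).mapL J.toContinuousLinearMap).const_smul z)
    have hs' := (hΘ z hz a).mapL J.toContinuousLinearMap
    have e : charOp T z (V a) = -(T (V a)) +
        z • defectOp (T†) (Ring.inverse (1 - z • (T†)) (defectOp T (V a))) := rfl
    rw [e, hTV, neg_zero, zero_add, defectOp_eq_of_isometry hV, defectOp_eq_of_isometry hJ,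
      comp_apply, comp_apply, LinearIsometry.coe_toContinuousLinearMap, adjoint_apply_isometry]
    refine hs.unique (hs'.congr_fun fun n => ?_)
    simp [smul_pow, pow_succ, smul_smul, mul_comm]
  refine ⟨(defectEquiv hV).symm, (defectEquiv hJ).symm, fun z hz x => ?_⟩
  obtain ⟨a, rfl⟩ := (defectEquiv hV).surjective x
  rw [LinearIsometryEquiv.symm_apply_apply, LinearIsometryEquiv.symm_apply_eq]
  exact Subtype.ext (key z hz a)

theorem norm_apply_sq_of_isometry {T : H →L[ℂ] H} {V : E →ₗᵢ[ℂ] H}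
    (hV : 1 - (T†) * T = V.toContinuousLinearMap ∘L (V.toContinuousLinearMap†)) (x : H) :
    ‖T x‖ ^ 2 = ‖x‖ ^ 2 - ‖(V.toContinuousLinearMap†) x‖ ^ 2 := by
  have h1 : x - (T†) (T x) = V.toContinuousLinearMap ((V.toContinuousLinearMap†) x) :=
    congrArg (fun A : H →L[ℂ] H => A x) hV
  rw [← inner_self_eq_norm_sq (𝕜 := ℂ), ← inner_self_eq_norm_sq (𝕜 := ℂ),
    ← inner_self_eq_norm_sq (𝕜 := ℂ), ← map_sub, adjoint_inner_left V.toContinuousLinearMap, ← h1,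
    inner_sub_right, adjoint_inner_right, sub_sub_cancel]

/-- On a reducing subspace where T is unitary, ‖Tx‖² = ‖x‖² - ‖V*x‖² and its analogue for T* and J
force V* and J* to vanish, hence to vanish along both orbits. -/
theorem isCNU_of_separating {T : H →L[ℂ] H} (hT : IsContraction T) {V : E →ₗᵢ[ℂ] H}
    {J : F →ₗᵢ[ℂ] H}
    (hV : 1 - (T†) * T = V.toContinuousLinearMap ∘L (V.toContinuousLinearMap†))
    (hJ : 1 - ((T†)†) * (T†) = J.toContinuousLinearMap ∘L (J.toContinuousLinearMap†))
    (hsep : ∀ x, (∀ n : ℕ, (J.toContinuousLinearMap†) (((T†) ^ n) x) = 0) →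
      (∀ n : ℕ, (V.toContinuousLinearMap†) ((T ^ n) x) = 0) → x = 0) : IsCNU T := by
  refine ⟨hT, fun L _ hL hL' hiso hsurj => (Submodule.eq_bot_iff L).mpr fun x hx => ?_⟩
  have hLV : ∀ x ∈ L, (V.toContinuousLinearMap†) x = 0 := by
    intro x hx
    have h1 := norm_apply_sq_of_isometry hV x
    rw [hiso x hx] at h1
    exact norm_eq_zero.mp (pow_eq_zero_iff two_ne_zero |>.mp (by linarith))
  have hLJ : ∀ x ∈ L, (J.toContinuousLinearMap†) x = 0 := by
    intro x hx
    obtain ⟨y, hy, rfl⟩ := hsurj x hx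
    have h2 : y - (T†) (T y) = V.toContinuousLinearMap ((V.toContinuousLinearMap†) y) :=
      congrArg (fun A : H →L[ℂ] H => A y) hV
    rw [hLV y hy, map_zero, sub_eq_zero] at h2
    have h1 := norm_apply_sq_of_isometry hJ (T y)
    rw [← h2, hiso y hy] at h1
    exact norm_eq_zero.mp (pow_eq_zero_iff two_ne_zero |>.mp (by linarith))
  have hpow : ∀ n : ℕ, ∀ x ∈ L, (T ^ n) x ∈ L ∧ ((T†) ^ n) x ∈ L := by
    intro n
    induction n with
    | zero => exact fun x hx => ⟨hx, hx⟩
    | succ n ih =>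
      intro x hx
      rw [pow_succ', pow_succ']
      exact ⟨hL _ (ih x hx).1, hL' _ (ih x hx).2⟩
  exact hsep x (fun n => hLJ _ (hpow n x hx).2) fun n => hLV _ (hpow n x hx).1

end Coincide

/-! ### The model operator, its defects and its powers -/

section ModelOperator

variable {E : Type*} [NormedAddCommGroup E] [InnerProductSpace ℂ E] [CompleteSpace E]
variable [TopologicalSpace.SeparableSpace E]
variable {F : Type*} [NormedAddCommGroup F] [InnerProductSpace ℂ F] [CompleteSpace F]

variable (E F) in
/-- The operator `u ⊕ v ↦ e^{-it} (u - û(0)) ⊕ e^{-it} v` on `L² ⊕ L²`. -/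
noncomputable def backwardShift :
    WithLp 2 (L2 F × L2 E) →L[ℂ] WithLp 2 (L2 F × L2 E) :=
  (WithLp.prodContinuousLinearEquiv 2 ℂ (L2 F) (L2 E)).symm.toContinuousLinearMap ∘L
    ContinuousLinearMap.prod
      ((mulExp (-1)).toContinuousLinearMap ∘L
        (1 - (mono 0).toContinuousLinearMap ∘L coeffL F 0) ∘L WithLp.fstL 2 ℂ (L2 F) (L2 E))
      ((mulExp (-1)).toContinuousLinearMap ∘L WithLp.sndL 2 ℂ (L2 F) (L2 E))

omit [TopologicalSpace.SeparableSpace E] in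
theorem inner_modelSpace {Θ : ℂ → E →L[ℂ] F} (x y : modelSpace Θ) :
    ⟪x, y⟫_ℂ = ⟪x.1.fst, y.1.fst⟫_ℂ + ⟪x.1.snd, y.1.snd⟫_ℂ := rfl

omit [CompleteSpace E] [TopologicalSpace.SeparableSpace E] [CompleteSpace F] in
theorem backwardShift_apply (x : WithLp 2 (L2 F × L2 E)) : backwardShift E F x =
    WithLp.toLp 2 (mulExp (-1) (x.fst - mono 0 (coeffL F 0 x.fst)), mulExp (-1) x.snd) := rfl

namespace IsOrthogonalSeries

variable {Θ : ℂ → E →L[ℂ] F} {η : ℕ → E →L[ℂ] F} (h : IsOrthogonalSeries Θ η)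
include h

theorem backwardShift_mem {x : WithLp 2 (L2 F × L2 E)} (hx : x ∈ modelSpace Θ) :
    backwardShift E F x ∈ modelSpace Θ := by
  rw [h.mem_modelSpace_iff_coeffL] at hx ⊢
  obtain ⟨⟨h1, h2⟩, h3, h4⟩ := hx
  simp only [backwardShift_apply, WithLp.toLp_fst, WithLp.toLp_snd, coeffL_mulExp, map_sub,
    coeffL_mono, sub_neg_eq_add]
  refine ⟨⟨fun n hn => ?_, fun k m => ?_⟩, fun n m => h3 _ m, fun n hn => h4 _ (by omega)⟩
  -- The only delicate index is n = -1, where û(0) would appear; the subtracted constant removes it.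
  · rcases eq_or_ne (n + 1) 0 with hn' | hn'
    · rw [if_pos hn', hn', sub_self]
    · rw [if_neg hn', sub_zero, h1 _ (by omega)]
  · rw [if_neg (by omega), map_zero, sub_zero]
    have h5 := h2 (k + 1) m
    push_cast at h5
    rw [← h5]
    congr 3
    ring

/-- The adjoint of the model operator. -/
noncomputable def modelShift : modelSpace Θ →L[ℂ] modelSpace Θ :=
  (backwardShift E F ∘L (modelSpace Θ).subtypeL).codRestrict (modelSpace Θ)
    fun x => h.backwardShift_mem x.2

theorem coe_modelShift (x : modelSpace Θ) : (h.modelShift x : WithLp 2 (L2 F × L2 E)) =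
    WithLp.toLp 2 (mulExp (-1) (x.1.fst - mono 0 (coeffL F 0 x.1.fst)), mulExp (-1) x.1.snd) :=
  rfl

theorem coeffL_fst_modelShift (x : modelSpace Θ) (n : ℕ) :
    coeffL F n (h.modelShift x).1.fst = coeffL F (n + 1) x.1.fst := by
  rw [h.coe_modelShift]
  change coeffL F n (mulExp (-1) (x.1.fst - mono 0 (coeffL F 0 x.1.fst))) = _
  rw [coeffL_mulExp, map_sub, coeffL_mono, if_neg (by omega), sub_zero, sub_neg_eq_add]

theorem coeffL_snd_modelShift (x : modelSpace Θ) (n : ℤ) :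
    coeffL E n (h.modelShift x).1.snd = coeffL E (n + 1) x.1.snd := by
  rw [h.coe_modelShift]
  change coeffL E n (mulExp (-1) x.1.snd) = _
  rw [coeffL_mulExp, sub_neg_eq_add]

theorem coeffL_fst_modelShift_pow (n : ℕ) (x : modelSpace Θ) (k : ℕ) :
    coeffL F k ((h.modelShift ^ n) x).1.fst = coeffL F (k + n : ℕ) x.1.fst := by
  induction n generalizing x with
  | zero => rfl
  | succ n ih =>
    rw [pow_succ, mul_apply_eq_comp, ih, h.coeffL_fst_modelShift]
    congr 2

theorem coeffL_snd_modelShift_pow (n : ℕ) (x : modelSpace Θ) (k : ℤ) :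
    coeffL E k ((h.modelShift ^ n) x).1.snd = coeffL E (k + n) x.1.snd := by
  induction n generalizing x with
  | zero => simp
  | succ n ih =>
    rw [pow_succ, mul_apply_eq_comp, ih, h.coeffL_snd_modelShift]
    congr 2
    push_cast; ring

variable [TopologicalSpace.SeparableSpace F]

theorem ext_modelSpace {x y : modelSpace Θ}
    (h1 : ∀ n : ℕ, coeffL F n x.1.fst = coeffL F n y.1.fst)
    (h2 : ∀ n : ℕ, coeffL E (-1 - n) x.1.snd = coeffL E (-1 - n) y.1.snd) : x = y := by
  obtain ⟨⟨hx1, -⟩, -, hx2⟩ := h.mem_modelSpace_iff_coeffL.mp x.2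
  obtain ⟨⟨hy1, -⟩, -, hy2⟩ := h.mem_modelSpace_iff_coeffL.mp y.2
  have e1 : x.1.fst = y.1.fst := L2_ext fun n => by
    rcases lt_or_ge n 0 with hn | hn
    · rw [hx1 n hn, hy1 n hn]
    · lift n to ℕ using hn
      exact h1 n
  have e2 : x.1.snd = y.1.snd := L2_ext fun n => by
    rcases lt_or_ge n 0 with hn | hn
    · obtain ⟨k, rfl⟩ : ∃ k : ℕ, n = -1 - k := ⟨(-1 - n).toNat, by omega⟩
      exact h2 k
    · rw [hx2 n hn, hy2 n hn]
  exact Subtype.ext ((WithLp.equiv 2 _).injective (Prod.ext e1 e2))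

theorem eq_zero_of_coeffL_eq_zero {x : modelSpace Θ} (h1 : ∀ n : ℕ, coeffL F n x.1.fst = 0)
    (h2 : ∀ n : ℕ, coeffL E (-1 - n) x.1.snd = 0) : x = 0 := by
  refine h.ext_modelSpace (fun n => ?_) (fun n => ?_)
  · rw [h1, Submodule.coe_zero, WithLp.zero_fst, map_zero]
  · rw [h2, Submodule.coe_zero, WithLp.zero_snd, map_zero]

omit [TopologicalSpace.SeparableSpace F] in
theorem inner_modelShift (x y : modelSpace Θ) : ⟪h.modelShift x, h.modelShift y⟫_ℂ =
    ⟪x, y⟫_ℂ - ⟪coeffL F 0 x.1.fst, coeffL F 0 y.1.fst⟫_ℂ := by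
  rw [inner_modelSpace, inner_modelSpace, h.coe_modelShift, h.coe_modelShift]
  change ⟪mulExp (-1) (x.1.fst - mono 0 (coeffL F 0 x.1.fst)),
    mulExp (-1) (y.1.fst - mono 0 (coeffL F 0 y.1.fst))⟫_ℂ +
    ⟪mulExp (-1) x.1.snd, mulExp (-1) y.1.snd⟫_ℂ = _
  rw [LinearIsometry.inner_map_map, LinearIsometry.inner_map_map, inner_sub_left, inner_mono_left,
    map_sub, coeffL_mono, if_pos rfl, sub_self, inner_zero_right, sub_zero, inner_sub_right,
    ← inner_conj_symm x.1.fst (mono 0 _), inner_mono_left, inner_conj_symm]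
  ring

omit [TopologicalSpace.SeparableSpace F] in
theorem norm_modelShift_sq (x : modelSpace Θ) :
    ‖h.modelShift x‖ ^ 2 = ‖x‖ ^ 2 - ‖coeffL F 0 x.1.fst‖ ^ 2 := by
  have h1 := congrArg (RCLike.re (K := ℂ)) (h.inner_modelShift x x)
  have h2 : ∀ y : modelSpace Θ, RCLike.re ⟪y, y⟫_ℂ = ‖y‖ ^ 2 := fun y => inner_self_eq_norm_sq y
  rwa [map_sub, h2, h2, inner_self_eq_norm_sq] at h1

omit [TopologicalSpace.SeparableSpace F] in
theorem isContraction_modelShift : IsContraction h.modelShift := fun x => by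
  refine (sq_le_sq₀ (norm_nonneg _) (norm_nonneg _)).mp ?_
  rw [h.norm_modelShift_sq]
  linarith [sq_nonneg ‖coeffL F 0 x.1.fst‖]

-- The condition at (k, m) bears on e^{int} b only if n = k+m+1, which forces m < n. These vectors
-- supply the constants (n = 0) and test vectors in kernels of powers of R.
omit [TopologicalSpace.SeparableSpace F] in
theorem mono_mem_modelSpace (n : ℕ) {b : F} (hb : ∀ m < n, ((η m)†) b = 0) :
    WithLp.toLp 2 (mono n b, (0 : L2 E)) ∈ modelSpace Θ := by
  rw [h.mem_modelSpace_iff_coeffL]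
  simp only [WithLp.toLp_fst, WithLp.toLp_snd, map_zero, implies_true, and_true, coeffL_mono]
  refine ⟨fun k hk => if_neg (by omega), fun k m => ?_⟩
  split_ifs with hk
  · exact hb m (by omega)
  · exact map_zero _

/-- The embedding of `F` as the constant functions in the first component of the model space. -/
noncomputable def constEmbedding : F →ₗᵢ[ℂ] modelSpace Θ where
  toFun b := ⟨WithLp.toLp 2 (mono ((0 : ℕ) : ℤ) b, (0 : L2 E)), h.mono_mem_modelSpace 0 (by simp)⟩
  map_add' a b := Subtype.ext ((WithLp.equiv 2 _).injective
    (Prod.ext (map_add _ a b) (add_zero 0).symm))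
  map_smul' c a := Subtype.ext ((WithLp.equiv 2 _).injective
    (Prod.ext (map_smul _ c a) (smul_zero c).symm))
  norm_map' b := by
    refine (sq_eq_sq₀ (norm_nonneg _) (norm_nonneg _)).mp ?_
    rw [← inner_self_eq_norm_sq (𝕜 := ℂ), inner_modelSpace]
    change RCLike.re (⟪mono 0 b, mono 0 b⟫_ℂ + ⟪(0 : L2 E), 0⟫_ℂ) = _
    rw [LinearIsometry.inner_map_map, inner_zero_left, add_zero, inner_self_eq_norm_sq]

omit [TopologicalSpace.SeparableSpace F] in
theorem adjoint_constEmbedding (x : modelSpace Θ) :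
    (h.constEmbedding.toContinuousLinearMap†) x = coeffL F 0 x.1.fst := by
  refine ext_inner_left ℂ fun b => ?_
  rw [adjoint_inner_right, inner_modelSpace]
  change ⟪mono 0 b, x.1.fst⟫_ℂ + ⟪(0 : L2 E), x.1.snd⟫_ℂ = _
  rw [inner_zero_left, add_zero, inner_mono_left]

omit [TopologicalSpace.SeparableSpace F] in
theorem one_sub_adjoint_mul_modelShift : 1 - (h.modelShift†) * h.modelShift =
    h.constEmbedding.toContinuousLinearMap ∘L (h.constEmbedding.toContinuousLinearMap†) := by
  refine ext fun y => ext_inner_left ℂ fun x => ?_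
  rw [sub_apply, one_apply_eq_self, mul_apply_eq_comp, inner_sub_right, adjoint_inner_right,
    h.inner_modelShift, sub_sub_cancel, comp_apply,
    ← adjoint_inner_left h.constEmbedding.toContinuousLinearMap, h.adjoint_constEmbedding,
    h.adjoint_constEmbedding]

omit [TopologicalSpace.SeparableSpace F] in
theorem defectEmbedding_mem (a : E) :
    WithLp.toLp 2 (laurent (boundary Θ) (mono (-1) a), laurent (delta Θ) (mono (-1) a)) ∈
      modelSpace Θ := by
  rw [h.mem_modelSpace_iff_coeffL]
  refine ⟨⟨fun n hn => h.coeffL_laurent_boundary_mono_of_le (by omega) a, fun k m => ?_⟩,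
    fun n m => ?_, fun n hn => ?_⟩
  -- The factor e^{-it} makes the coefficient of index k+m+1 equal to η_{k+m+1} a, which η_m* kills
  -- since the indices differ.
  · have h1 := h.coeffL_laurent_boundary_mono (-1) (k + m + 1) a
    rw [show (-1 + ((k + m + 1 : ℕ) : ℤ) + 1) = k + m + 1 by push_cast; ring] at h1
    change ((η m)†) (coeffL F (k + m + 1) (laurent (boundary Θ) (mono (-1) a))) = 0
    rw [h1, h.adjoint_apply_of_ne (by omega)]
  · change η m (coeffL E n (laurent (delta Θ) (mono (-1) a))) = 0
    rw [h.coeffL_laurent_delta, h.apply_deltaProj]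
  · change coeffL E n (laurent (delta Θ) (mono (-1) a)) = 0
    rw [h.coeffL_laurent_delta, coeffL_mono, if_neg (by omega), map_zero]

/-- The embedding `a ↦ e^{-it} (Θ a ⊕ Δ_Θ a)` of `E` in the model space. -/
noncomputable def defectEmbedding : E →ₗᵢ[ℂ] modelSpace Θ where
  toFun a := ⟨_, h.defectEmbedding_mem a⟩
  map_add' a b := Subtype.ext ((WithLp.equiv 2 _).injective
    (Prod.ext (by simp) (by simp)))
  map_smul' c a := Subtype.ext ((WithLp.equiv 2 _).injective
    (Prod.ext (by simp) (by simp)))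
  norm_map' a := by
    refine (sq_eq_sq₀ (norm_nonneg _) (norm_nonneg _)).mp ?_
    rw [← inner_self_eq_norm_sq (𝕜 := ℂ), inner_modelSpace]
    change RCLike.re (⟪laurent (boundary Θ) (mono (-1) a), laurent (boundary Θ) (mono (-1) a)⟫_ℂ +
      ⟪laurent (delta Θ) (mono (-1) a), laurent (delta Θ) (mono (-1) a)⟫_ℂ) = _
    rw [h.inner_laurent_boundary, h.inner_laurent_delta_left, h.laurent_delta_idem,
      ← inner_add_right, sub_add_cancel, LinearIsometry.inner_map_map, inner_self_eq_norm_sq]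

omit [TopologicalSpace.SeparableSpace F] in
theorem coeffL_fst_defectEmbedding (a : E) (n : ℕ) :
    coeffL F n (h.defectEmbedding a).1.fst = η n a := by
  have h1 := h.coeffL_laurent_boundary_mono (-1) n a
  rwa [show (-1 + (n : ℤ) + 1) = n by ring] at h1

-- A weak form of W*x = ∑ η_m* û(m) + v̂(-1).
omit [TopologicalSpace.SeparableSpace F] in
theorem hasSum_inner_defectEmbedding (a : E) (x : modelSpace Θ) :
    HasSum (fun m : ℕ => ⟪a, ((η m)†) (coeffL F m x.1.fst)⟫_ℂ)
      (⟪h.defectEmbedding a, x⟫_ℂ - ⟪a, coeffL E (-1) x.1.snd⟫_ℂ) := by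
  have h1 := h.hasSum_inner_laurent_boundary_mono (-1) a x.1.fst
  have h2 : laurent (delta Θ) x.1.snd = x.1.snd := (h.mem_modelSpace_iff.mp x.2).2.1
  have h3 : ⟪h.defectEmbedding a, x⟫_ℂ - ⟪a, coeffL E (-1) x.1.snd⟫_ℂ =
      ⟪laurent (boundary Θ) (mono (-1) a), x.1.fst⟫_ℂ := by
    rw [sub_eq_iff_eq_add, ← inner_mono_left, inner_modelSpace]
    change _ + ⟪laurent (delta Θ) (mono (-1) a), x.1.snd⟫_ℂ = _
    rw [h.inner_laurent_delta_left, h2]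
    rfl
  rw [h3]
  refine h1.congr_fun fun m => ?_
  rw [adjoint_inner_right, show (-1 + (m : ℤ) + 1) = m by ring]

-- Every term of ⟪W a, Rx⟫ vanishes: η_m* û(m+1) = 0 is membership of x with k = 0, and v̂(0) = 0.
omit [TopologicalSpace.SeparableSpace F] in
theorem adjoint_modelShift_defectEmbedding (a : E) :
    (h.modelShift†) (h.defectEmbedding a) = 0 := by
  refine ext_inner_right ℂ fun x => ?_
  obtain ⟨⟨-, h2⟩, -, h4⟩ := h.mem_modelSpace_iff_coeffL.mp x.2
  have h1 := h.hasSum_inner_defectEmbedding a (h.modelShift x)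
  rw [h.coeffL_snd_modelShift, h4 _ (by norm_num), inner_zero_right, sub_zero] at h1
  rw [adjoint_inner_left, inner_zero_left]
  refine h1.unique ?_
  convert hasSum_zero using 2 with m
  have h5 := h2 0 m
  rw [Nat.cast_zero, zero_add] at h5
  rw [h.coeffL_fst_modelShift, h5, inner_zero_right]

omit [TopologicalSpace.SeparableSpace F] in
theorem coeffL_eq_zero_of_adjoint_defectEmbedding_eq_zero {x : modelSpace Θ}
    (hx : (h.defectEmbedding.toContinuousLinearMap†) x = 0) :
    (∀ m : ℕ, ((η m)†) (coeffL F m x.1.fst) = 0) ∧ coeffL E (-1) x.1.snd = 0 := by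
  obtain ⟨-, h3, -⟩ := h.mem_modelSpace_iff_coeffL.mp x.2
  have h0 : ∀ a, ⟪h.defectEmbedding a, x⟫_ℂ = 0 := fun a => by
    have := adjoint_inner_right h.defectEmbedding.toContinuousLinearMap a x
    rw [hx, inner_zero_right] at this
    exact this.symm
  have h1 : ∀ m : ℕ, ((η m)†) (coeffL F m x.1.fst) = 0 := by
    intro m
    set b := coeffL F m x.1.fst
    -- Testing with η_m* b isolates the m-th term, because η_k η_m* = 0 for k ≠ m and η_m v̂(-1) =
    -- 0.
    have h2 := h.hasSum_inner_defectEmbedding (((η m)†) b) x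
    rw [h0, adjoint_inner_left, h3, inner_zero_right, sub_zero] at h2
    refine inner_self_eq_zero.mp ((hasSum_single m fun k hk => ?_).unique h2)
    rw [adjoint_inner_right, h.apply_adjoint_of_ne hk, inner_zero_left]
  refine ⟨h1, ?_⟩
  have h2 := h.hasSum_inner_defectEmbedding (coeffL E (-1) x.1.snd) x
  simp only [h1, inner_zero_right, h0, zero_sub] at h2
  exact inner_self_eq_zero.mp (neg_eq_zero.mp (h2.unique hasSum_zero))

-- The preimage is e^{it}x. It lies in the model space because the extra conditions, η_m* û(m) = 0
-- and v̂(-1) = 0, are what W*x = 0 provides.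
omit [TopologicalSpace.SeparableSpace F] in
theorem exists_modelShift_eq {x : modelSpace Θ}
    (hx : (h.defectEmbedding.toContinuousLinearMap†) x = 0) : ∃ y, h.modelShift y = x := by
  obtain ⟨h1, h2⟩ := h.coeffL_eq_zero_of_adjoint_defectEmbedding_eq_zero hx
  obtain ⟨⟨h3, h4⟩, h5, h6⟩ := h.mem_modelSpace_iff_coeffL.mp x.2
  have hy : WithLp.toLp 2 (mulExp 1 x.1.fst, mulExp 1 x.1.snd) ∈ modelSpace Θ := by
    rw [h.mem_modelSpace_iff_coeffL]
    simp only [WithLp.toLp_fst, WithLp.toLp_snd, coeffL_mulExp]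
    refine ⟨⟨fun n hn => h3 _ (by omega), fun k m => ?_⟩, fun n m => h5 _ m, fun n hn => ?_⟩
    · rw [add_sub_cancel_right]
      cases k with
      | zero => simpa using h1 m
      | succ k =>
        have h7 := h4 k m
        rw [← h7, show (((k + 1 : ℕ) : ℤ) + m) = k + m + 1 by push_cast; ring]
    · rcases hn.eq_or_lt with rfl | hn
      · exact h2
      · exact h6 _ (by omega)
  refine ⟨⟨_, hy⟩, Subtype.ext ?_⟩
  rw [h.coe_modelShift]
  refine (WithLp.equiv 2 _).injective (Prod.ext ?_ ?_)
  · change mulExp (-1) (mulExp 1 x.1.fst - mono 0 (coeffL F 0 (mulExp 1 x.1.fst))) = x.1.fst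
    rw [coeffL_mulExp, h3 _ (by norm_num), map_zero, sub_zero, mulExp_mulExp]
    exact mulExp_zero _
  · change mulExp (-1) (mulExp 1 x.1.snd) = x.1.snd
    rw [mulExp_mulExp]
    exact mulExp_zero _

theorem isPartialIsometry_modelShift_pow (n : ℕ) : IsPartialIsometry (h.modelShift ^ n) := by
  have hn : ∀ (n : ℕ) (x : modelSpace Θ), (∀ i : ℕ, i < n → coeffL F i x.1.fst = 0) →
      ‖(h.modelShift ^ n) x‖ = ‖x‖ := by
    intro n
    induction n with
    | zero => intro x _; rfl
    | succ n ih =>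
      intro x hx
      rw [pow_succ, mul_apply_eq_comp, ih _ fun i hi => ?_]
      · refine (sq_eq_sq₀ (norm_nonneg _) (norm_nonneg _)).mp ?_
        have h0 := hx 0 (by omega)
        rw [Nat.cast_zero] at h0
        rw [h.norm_modelShift_sq, h0, norm_zero]
        ring
      · rw [h.coeffL_fst_modelShift]
        exact_mod_cast hx (i + 1) (by omega)
  intro x hx
  refine hn n x fun i hi => ?_
  obtain ⟨⟨-, h2⟩, -, -⟩ := h.mem_modelSpace_iff_coeffL.mp x.2
  have hb : ∀ m < i, ((η m)†) (coeffL F i x.1.fst) = 0 := by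
    intro m hm
    obtain ⟨k, rfl⟩ : ∃ k, i = k + m + 1 := ⟨i - m - 1, by omega⟩
    exact_mod_cast h2 k m
  -- For i < n the vector e^{iit} û(i) ⊕ 0 lies in ker Rⁿ; orthogonality of x to it reads ‖û(i)‖² =
  -- 0.
  have h3 := hx ⟨_, h.mono_mem_modelSpace i hb⟩ (by
    change (h.modelShift ^ n) _ = 0
    refine h.ext_modelSpace (fun k => ?_) (fun k => ?_)
    · rw [h.coeffL_fst_modelShift_pow]
      change coeffL F _ (mono i _) = coeffL F _ 0
      rw [coeffL_mono, if_neg (by omega), map_zero]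
    · rw [h.coeffL_snd_modelShift_pow]
      change coeffL E _ 0 = coeffL E _ 0
      rw [map_zero, map_zero])
  rw [inner_modelSpace] at h3
  change ⟪mono i _, x.1.fst⟫_ℂ + ⟪(0 : L2 E), x.1.snd⟫_ℂ = 0 at h3
  rwa [inner_zero_left, add_zero, inner_mono_left, inner_self_eq_zero] at h3

/-- The vector x - WW*x is in the range of R, so the partial isometry R satisfies RR* = 1 on it,
while R*W = 0. -/
theorem apply_sub_modelShift_adjoint (x : modelSpace Θ) :
    x - h.modelShift ((h.modelShift†) x) =
      h.defectEmbedding ((h.defectEmbedding.toContinuousLinearMap†) x) := by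
  set R := h.modelShift
  set W := h.defectEmbedding
  obtain ⟨y, hy⟩ := h.exists_modelShift_eq (x := x - W ((W.toContinuousLinearMap†) x)) (by
    rw [map_sub]
    exact sub_eq_zero.mpr (adjoint_apply_isometry W _).symm)
  have h1 := (isPartialIsometry_iff R).mp (by simpa using h.isPartialIsometry_modelShift_pow 1) y
  rw [hy, map_sub, h.adjoint_modelShift_defectEmbedding, sub_zero] at h1
  rw [h1, sub_sub_cancel]

theorem one_sub_modelShift_mul_adjoint : 1 - h.modelShift * (h.modelShift†) =
    h.defectEmbedding.toContinuousLinearMap ∘L (h.defectEmbedding.toContinuousLinearMap†) :=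
  ext h.apply_sub_modelShift_adjoint

theorem isPowerPartialIsometry_adjoint_modelShift : IsPowerPartialIsometry (h.modelShift†) := by
  intro n _
  rw [← star_eq_adjoint, ← star_pow, star_eq_adjoint]
  exact (h.isPartialIsometry_modelShift_pow n).adjoint

theorem modelShift_pow_adjoint_pow {x : modelSpace Θ}
    (hx : ∀ n : ℕ, (h.defectEmbedding.toContinuousLinearMap†) (((h.modelShift†) ^ n) x) = 0)
    (n : ℕ) : (h.modelShift ^ n) (((h.modelShift†) ^ n) x) = x := by
  induction n with
  | zero => rfl
  | succ n ih =>
    have h1 := h.apply_sub_modelShift_adjoint (((h.modelShift†) ^ n) x)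
    rw [hx n, map_zero] at h1
    rw [pow_succ, pow_succ', mul_apply_eq_comp, mul_apply_eq_comp, ← sub_eq_zero.mp h1, ih]

theorem isCNU_adjoint_modelShift : IsCNU (h.modelShift†) := by
  refine isCNU_of_separating (V := h.defectEmbedding) (J := h.constEmbedding)
    (isContraction_adjoint h.isContraction_modelShift) ?_ ?_ fun x hJ hV => ?_
  · rw [adjoint_adjoint, h.one_sub_modelShift_mul_adjoint]
  · rw [adjoint_adjoint h.modelShift, h.one_sub_adjoint_mul_modelShift]
  · rw [adjoint_adjoint] at hJ
    refine h.eq_zero_of_coeffL_eq_zero (fun n => ?_) fun n => ?_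
    · have h1 := hJ n
      rw [h.adjoint_constEmbedding] at h1
      have h2 := h.coeffL_fst_modelShift_pow n x 0
      rw [zero_add] at h2
      exact h2.symm.trans h1
    -- Since x = Rⁿ R*ⁿ x, the coefficient v̂(-1-n) of x is the coefficient of index -1 of R*ⁿ x,
    -- where W* vanishes.
    · rw [← h.modelShift_pow_adjoint_pow hV n, h.coeffL_snd_modelShift_pow, sub_add_cancel]
      exact (h.coeffL_eq_zero_of_adjoint_defectEmbedding_eq_zero (hV n)).2

/-- The moment J* Rⁿ W a is the n-th coefficient of the first component of W a, that is η_n a. -/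
theorem coincide_charFun_adjoint_modelShift (hT : IsContraction (h.modelShift†)) :
    Coincide (E := defectSpace (h.modelShift†)) (F := defectSpace ((h.modelShift†)†))
      (charFun (h.modelShift†) hT) Θ := by
  refine coincide_charFun hT (V := h.defectEmbedding) (J := h.constEmbedding) ?_ ?_
    h.adjoint_modelShift_defectEmbedding fun z hz a => ?_
  · rw [adjoint_adjoint, h.one_sub_modelShift_mul_adjoint]
  · rw [adjoint_adjoint h.modelShift, h.one_sub_adjoint_mul_modelShift]
  · refine (h.hasSum z hz a).congr_fun fun n => ?_
    have h1 := h.coeffL_fst_modelShift_pow n (h.defectEmbedding a) 0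
    rw [zero_add, h.coeffL_fst_defectEmbedding] at h1
    rw [adjoint_adjoint, h.adjoint_constEmbedding, ← h1]
    rfl

omit [TopologicalSpace.SeparableSpace F] in
theorem modelShift_ae (x : modelSpace Θ) : ∀ᵐ t ∂μ𝕋,
    (h.modelShift x : WithLp 2 (L2 F × L2 E)).fst t =
      expi (-1) t • ((x : WithLp 2 (L2 F × L2 E)).fst t
        - discValue (x : WithLp 2 (L2 F × L2 E)).fst 0) ∧
    (h.modelShift x : WithLp 2 (L2 F × L2 E)).snd t =
      expi (-1) t • (x : WithLp 2 (L2 F × L2 E)).snd t := by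
  set c := coeffL F 0 x.1.fst with hc
  filter_upwards [mulExp_coeFn (-1) (x.1.fst - mono 0 c), mulExp_coeFn (-1) x.1.snd,
    Lp.coeFn_sub x.1.fst (mono 0 c), mono_coeFn 0 c] with t h1 h2 h3 h4
  refine ⟨?_, h2⟩
  change mulExp (-1) (x.1.fst - mono 0 c) t = _
  rw [h1, h3, Pi.sub_apply, h4, discValue_zero, ← coeffL_apply, ← hc]
  simp [expi]

end IsOrthogonalSeries

end ModelOperator

end PowerPartial

/-! ### The main theorem -/

open PowerPartial in
theorem mainTheorem1
    {E : Type*} [NormedAddCommGroup E] [InnerProductSpace ℂ E] [CompleteSpace E]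
    [TopologicalSpace.SeparableSpace E]
    {F : Type*} [NormedAddCommGroup F] [InnerProductSpace ℂ F] [CompleteSpace F]
    [TopologicalSpace.SeparableSpace F]
    (Θ : ℂ → E →L[ℂ] F) (hΘ : IsPurelyContractiveAnalytic Θ)
    (θ : ℕ → E →L[ℂ] F) (hθ : ∀ m : ℕ, 1 ≤ m → IsPartialIsometry (θ m))
    (hsum : ∀ z ∈ Metric.ball (0 : ℂ) 1, HasSum (fun m : ℕ => z ^ (m + 1) • θ (m + 1)) (Θ z)) :
    -- the boundary function exists almost everywhere and is bounded
    (∀ᵐ t ∂μ𝕋, IsRadialLimit Θ t (boundary Θ t)) ∧ IsLInfty (boundary Θ) ∧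
    -- `Δ_Θ` is a constant projection and squares to `I - Θ* Θ`
    (∃ P : E →L[ℂ] E, IsStarProjection P ∧ ∀ᵐ t ∂μ𝕋, delta Θ t = P ∧
      delta Θ t ∘L delta Θ t = 1 - (boundary Θ t)† ∘L boundary Θ t) ∧
    -- the explicit form of the model space
    (modelSpace Θ : Set (WithLp 2 (L2 F × L2 E))) =
      {x | ∃ f : H2 F, ∃ g ∈ (H2 E)ᗮ,
        x = WithLp.toLp 2
          (((f - toeplitz (boundary Θ) (((toeplitz (boundary Θ))†) f) : H2 F) : L2 F),
            laurent (delta Θ) g)} ∧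
    -- the model operator
    ∃ T : modelSpace Θ →L[ℂ] modelSpace Θ,
      (∀ x : modelSpace Θ, ∀ᵐ t ∂μ𝕋,
        ((T†) x : WithLp 2 (L2 F × L2 E)).fst t =
            expi (-1) t • ((x : WithLp 2 (L2 F × L2 E)).fst t
              - discValue (x : WithLp 2 (L2 F × L2 E)).fst 0) ∧
        ((T†) x : WithLp 2 (L2 F × L2 E)).snd t =
            expi (-1) t • (x : WithLp 2 (L2 F × L2 E)).snd t) ∧
      IsPowerPartialIsometry T ∧ IsCNU T ∧
      ∃ hT : IsContraction T, Coincide (E := defectSpace T) (F := defectSpace (T†)) (charFun T hT) Θ := by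
  have h : IsOrthogonalSeries Θ (fun m => θ (m + 1)) :=
    isOrthogonalSeries_of_isPartialIsometry (fun m => hθ (m + 1) (Nat.succ_pos m)) hsum
      hΘ.contractive
  refine ⟨ae_of_all _ h.isRadialLimit_boundary, h.isLInfty_boundary,
    ⟨deltaProj Θ, h.isStarProjection_deltaProj, ae_of_all _ fun t => ⟨h.delta_eq t, ?_⟩⟩,
    h.coe_modelSpace_eq, h.modelShift†, fun x => ?_,
    h.isPowerPartialIsometry_adjoint_modelShift, h.isCNU_adjoint_modelShift,
    isContraction_adjoint h.isContraction_modelShift,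
    h.coincide_charFun_adjoint_modelShift _⟩
  · rw [h.delta_eq, h.adjoint_boundary_comp_boundary t 0]
    exact h.isStarProjection_deltaProj.isIdempotentElem
  · rw [adjoint_adjoint]
    exact h.modelShift_ae x
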